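/- Let $1\le d\le n$ be integers, let $R_d$ be the rectangular partition with $d$ rows and $n-d$ columns, let $\lambda=(\lambda_1\ge\dots\ge\lambda_d\ge 0)$ be a partition contained in $R_d$, and put $\lambda^\vee=(n-d-\lambda_d,\dots,n-d-\lambda_1)$. For a partition $\mu$, let $G_\mu=\sum_T(-1)^{|T|-|\mu|}x^T$ be the stable Grothendieck polynomial, a formal power series over $\mathbb{C}$ in $x_1,x_2,\dots$. Here $T$ runs over the set-valued tableaux of shape $\mu$, i.e. fillings of the boxes of $\mu$ with non-empty finite sets of positive integers that increase weakly along rows and strictly down columns; $x^T=\prod_k x_k^{m_k}$, where $m_k$ is the number of boxes of $T$ containing $k$, and $|T|=\sum_k m_k$. (1) For every partition $\mu$ there is a unique finitely supported family of integers $(c_{\lambda,\mu}^{\nu})_\nu$, the K-theoretic Littlewood–Richardson coefficients, with $$G_\lambda\cdot G_\mu=\sum_\nu(-1)^{|\nu|-|\lambda|-|\mu|}\,c_{\lambda,\mu}^{\nu}\,G_\nu,$$ where $\nu$ runs over all partitions, and $$c_{\lambda,\mu}^{R_d}=\delta_{\lambda^\vee,\mu}.$$ (2) Equivalently, $G_\lambda^\perp\cdot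 g_{R_d}=g_{\lambda^\vee}$. Here $\Lambda=\mathbb{C}[h_1,h_2,\dots]$ is the ring of symmetric functions, and $\langle\cdot,\cdot\rangle$ is the Hall pairing of $\Lambda$ with symmetric formal power series, for which $\langle h_\mu,f\rangle$ is the coefficient of $x_1^{\mu_1}x_2^{\mu_2}\cdots$ in $f$. The dual stable Grothendieck polynomials $g_\mu\in\Lambda$ form the unique family with $\langle g_\mu,G_\nu\rangle=\delta_{\mu,\nu}$ for all partitions $\mu,\nu$, and $G_\lambda^\perp:\Lambda\to\Lambda$ is the unique linear operator with $\langle G_\lambda^\perp p,u\rangle=\langle p,G_\lambda u\rangle$ for all $p\in\Lambda$ and all symmetric formal power series $u$. -/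

import Mathlib

namespace KGroth

/-- The rectangular partition with `a` rows and `b` columns. -/
def rect (a b : ℕ) : YoungDiagram where
  cells := Finset.range a ×ˢ Finset.range b
  isLowerSet := by
    rintro ⟨i, j⟩ ⟨i', j'⟩ h hc
    obtain ⟨h1, h2⟩ := Prod.mk_le_mk.mp h
    simp only [Finset.coe_product, Set.mem_prod, Finset.coe_range, Set.mem_Iio] at hc ⊢
    omega

/-- The dual partition `(b - lam_a, b - lam_{a-1}, …, b - lam_1)` of `lam` in the rectangle with
`a` rows and `b` columns (rows are counted from `0` in the code). -/
def dualIn (a b : ℕ) (lam : YoungDiagram) : YoungDiagram where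
  cells := (Finset.range a ×ˢ Finset.range b).filter
    fun c => c.2 < b - lam.rowLen (a - 1 - c.1)
  isLowerSet := by
    rintro ⟨i, j⟩ ⟨i', j'⟩ h hc
    obtain ⟨h1, h2⟩ := Prod.mk_le_mk.mp h
    simp only [Finset.coe_filter, Finset.mem_product, Finset.mem_range, Set.mem_ofPred_eq] at hc ⊢
    have := lam.rowLen_anti (a - 1 - i) (a - 1 - i') (by omega)
    omega

/-- Set-valued (semistandard) tableaux of shape `mu`: each box holds a non-empty finite set of
letters, rows increase weakly and columns increase strictly (every letter of the one box against
every letter of the other). The letters are `0, 1, 2, …`, standing for the variables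
`x_1, x_2, x_3, …`. -/
structure SetValuedTableau (mu : YoungDiagram) where
  entry : ℕ → ℕ → Finset ℕ
  nonempty : ∀ {i j : ℕ}, (i, j) ∈ mu → (entry i j).Nonempty
  row_weak : ∀ {i j₁ j₂ : ℕ}, j₁ < j₂ → (i, j₂) ∈ mu →
    ∀ a ∈ entry i j₁, ∀ b ∈ entry i j₂, a ≤ b
  col_strict : ∀ {i₁ i₂ j : ℕ}, i₁ < i₂ → (i₂, j) ∈ mu →
    ∀ a ∈ entry i₁ j, ∀ b ∈ entry i₂ j, a < b
  empty_off : ∀ {i j : ℕ}, (i, j) ∉ mu → entry i j = ∅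

/-- The number of boxes of `T` that contain the letter `k`: the exponent of the `k`-th variable
in the monomial `x^T`. -/
def SetValuedTableau.content {mu : YoungDiagram} (T : SetValuedTableau mu) (k : ℕ) : ℕ :=
  (mu.cells.filter fun c => k ∈ T.entry c.1 c.2).card

/-- The stable Grothendieck polynomial `G_mu = ∑_T (-1)^(|T| - |mu|) x^T`, the sum over all
set-valued tableaux of shape `mu`, as a formal power series in infinitely many variables. -/
noncomputable def stableG (mu : YoungDiagram) : MvPowerSeries ℕ ℂ := fun m =>
  (-1 : ℂ) ^ ((m.degree : ℤ) - (mu.card : ℤ)) *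
    (Nat.card {T : SetValuedTableau mu // ∀ k, T.content k = m k} : ℂ)

/-- `c` is the family `(c_{lam,mu}^nu)_nu` of K-theoretic Littlewood–Richardson coefficients:
`G_lam * G_mu = ∑_nu (-1)^(|nu| - |lam| - |mu|) c_nu G_nu`. -/
def IsLRFamily (lam mu : YoungDiagram) (c : YoungDiagram →₀ ℤ) : Prop :=
  stableG lam * stableG mu = c.sum fun nu a =>
    ((-1 : ℂ) ^ ((nu.card : ℤ) - (lam.card : ℤ) - (mu.card : ℤ)) * (a : ℂ)) • stableG nu

/-- The ring of symmetric functions, as the polynomial ring `ℂ[h_1, h_2, …]`; the variable `X i`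
is the complete symmetric function `h_(i+1)`. -/
abbrev SymFun : Type := MvPolynomial ℕ ℂ

/-- The monomial `∏_i X_i^(α_i)` is `h_lam`, where the partition `lam` has `α_i` parts equal
to `i + 1`. This is the exponent of the monomial `x^lam = x_1^(lam_1) x_2^(lam_2) ⋯`. -/
noncomputable def partsExponent (α : ℕ →₀ ℕ) : ℕ →₀ ℕ :=
  (((Finsupp.toMultiset α).map (· + 1)).sort (· ≥ ·)).toFinsupp

/-- Symmetric formal power series in infinitely many variables (the completed ring of symmetric
functions). -/
def IsSymm (f : MvPowerSeries ℕ ℂ) : Prop :=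
  ∀ (σ : Equiv.Perm ℕ) (m : ℕ →₀ ℕ),
    MvPowerSeries.coeff (m.mapDomain σ) f = MvPowerSeries.coeff m f

/-- The Hall pairing of a symmetric function with a symmetric formal power series: the `h_lam` are
dual to the monomial symmetric functions, so that `⟨h_lam, f⟩` is the coefficient of `x^lam`
in `f`. -/
noncomputable def hall (p : SymFun) (f : MvPowerSeries ℕ ℂ) : ℂ :=
  ∑ α ∈ p.support, MvPolynomial.coeff α p * MvPowerSeries.coeff (partsExponent α) f

open Classical in
/-- `g` is the family of dual stable Grothendieck polynomials: `⟨g_lam, G_mu⟩ = δ_{lam,mu}`. -/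
def IsDualFamily (g : YoungDiagram → SymFun) : Prop :=
  ∀ lam mu : YoungDiagram, hall (g lam) (stableG mu) = if lam = mu then 1 else 0

/-- `D` is the operator `f^⊥` on symmetric functions, adjoint to multiplication by `f` under the
Hall pairing: `⟨f^⊥ p, u⟩ = ⟨p, f u⟩`. -/
def IsPerp (f : MvPowerSeries ℕ ℂ) (D : SymFun →ₗ[ℂ] SymFun) : Prop :=
  ∀ (p : SymFun) (u : MvPowerSeries ℕ ℂ), IsSymm u → hall (D p) u = hall p (f * u)

end KGroth

namespace KGroth

open Finset

section Bialternant

variable {R : Type*} [CommRing R]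

/-- The weight of one row in the branching rule: `a`, `c` are consecutive parts of the outer
partition, `b` is the part of the inner partition between them, `y` is the last variable. -/
def branchWeight (y : R) (a c b : ℕ) : R := y ^ (a - b) * if c < b then 1 - y else 1

/-- The stable Grothendieck polynomial in `N` variables of the partition with parts `a`, given by
the branching rule. -/
def grothPoly : (N : ℕ) → (Fin N → R) → (Fin N → ℕ) → R
  | 0, _, _ => 1
  | N + 1, x, a => x (Fin.last N) ^ a (Fin.last N) *
      ∑ b ∈ Fintype.piFinset fun i : Fin N => Icc (a i.succ) (a i.castSucc),
        (∏ i, branchWeight (x (Fin.last N)) (a i.castSucc) (a i.succ) (b i)) *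
          grothPoly N (x ∘ Fin.castSucc) b

/-- The alternant `det (x_i ^ (a_j + N - 1 - j) * (1 - x_i) ^ j)`. -/
def altDet {N : ℕ} (x : Fin N → R) (a : Fin N → ℕ) : R :=
  (Matrix.of fun j i : Fin N => x i ^ (a j + (N - 1 - j)) * (1 - x i) ^ (j : ℕ)).det

theorem map_branchWeight {S : Type*} [CommRing S] (f : R →+* S) (y : R) (a c b : ℕ) :
    f (branchWeight y a c b) = branchWeight (f y) a c b := by
  unfold branchWeight
  split_ifs <;> simp

theorem map_grothPoly {S : Type*} [CommRing S] (f : R →+* S) {N : ℕ} (x : Fin N → R)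
    (a : Fin N → ℕ) : f (grothPoly N x a) = grothPoly N (f ∘ x) a := by
  induction N with
  | zero => simp [grothPoly]
  | succ N ih =>
    simp only [grothPoly, map_mul, map_pow, map_sum, map_prod, map_branchWeight, ih]
    rfl

theorem map_altDet {S : Type*} [CommRing S] (f : R →+* S) {N : ℕ} (x : Fin N → R)
    (a : Fin N → ℕ) : f (altDet x a) = altDet (f ∘ x) a := by
  unfold altDet
  rw [RingHom.map_det]
  congr 1
  ext j i
  simp

theorem altDet_comp_perm {N : ℕ} (x : Fin N → R) (a : Fin N → ℕ) (σ : Equiv.Perm (Fin N)) :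
    altDet (x ∘ σ) a = Equiv.Perm.sign σ * altDet x a := by
  unfold altDet
  rw [← Matrix.det_permute']
  rfl

theorem sub_mul_sum_branchWeight (x y : R) {a c : ℕ} (h : c ≤ a) :
    (x - y) * ∑ b ∈ Icc c a, branchWeight y a c b * x ^ b =
      (1 - y) * x ^ (a + 1) - (1 - x) * (x ^ c * y ^ (a - c + 1)) := by
  induction a, h using Nat.le_induction with
  | base => simp [branchWeight]; ring
  | succ a h ih =>
    rw [← Finset.insert_Icc_right_eq_Icc_add_one (by omega), Finset.sum_insert (by simp), mul_add]
    have : ∑ b ∈ Icc c a, branchWeight y (a + 1) c b * x ^ b =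
        y * ∑ b ∈ Icc c a, branchWeight y a c b * x ^ b := by
      rw [Finset.mul_sum]
      refine Finset.sum_congr rfl fun b hb => ?_
      have hb := (Finset.mem_Icc.mp hb).2
      rw [branchWeight, branchWeight, show a + 1 - b = a - b + 1 by omega]
      ring
    rw [this, mul_left_comm (x - y) y, ih, branchWeight, if_pos (by omega),
      show a + 1 - c + 1 = a - c + 1 + 1 by omega]
    simp
    ring

theorem sum_prod_branchWeight_mul_altDet {N : ℕ} (x : Fin N → R) (y : R) (a : Fin (N + 1) → ℕ)
    (ha : Antitone a) :
    (∏ i, (x i - y)) * ∑ b ∈ Fintype.piFinset fun i : Fin N => Icc (a i.succ) (a i.castSucc),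
        (∏ i, branchWeight y (a i.castSucc) (a i.succ) (b i)) * altDet x b =
      (Matrix.of fun j i : Fin N => x i ^ (N - 1 - (j : ℕ)) * (1 - x i) ^ (j : ℕ) *
        ((1 - y) * x i ^ (a j.castSucc + 1) -
          (1 - x i) * (x i ^ a j.succ * y ^ (a j.castSucc - a j.succ + 1)))).det := by
  have h1 : ∑ b ∈ Fintype.piFinset fun i : Fin N => Icc (a i.succ) (a i.castSucc),
        (∏ i, branchWeight y (a i.castSucc) (a i.succ) (b i)) * altDet x b =
      (Matrix.of fun j i : Fin N => ∑ b ∈ Icc (a j.succ) (a j.castSucc),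
        branchWeight y (a j.castSucc) (a j.succ) b *
          (x i ^ (b + (N - 1 - j)) * (1 - x i) ^ (j : ℕ))).det := by
    have := (Matrix.detRowAlternating (n := Fin N) (R := R)).toMultilinearMap.map_sum_finset
      (fun j b => branchWeight y (a j.castSucc) (a j.succ) b •
          fun i => (x i ^ (b + (N - 1 - j)) * (1 - x i) ^ (j : ℕ)))
      (fun i : Fin N => Icc (a i.succ) (a i.castSucc))
    simp only [MultilinearMap.map_smul_univ] at this
    refine this.symm.trans ?_
    change Matrix.det _ = _
    congr 1
    ext j i
    simp [Finset.sum_apply]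
  rw [h1, ← Matrix.det_mul_row]
  congr 1
  ext j i
  simp only [Matrix.of_apply]
  rw [← sub_mul_sum_branchWeight _ _ (ha (Fin.castSucc_le_succ j)), Finset.mul_sum,
    Finset.mul_sum, Finset.mul_sum]
  refine Finset.sum_congr rfl fun b _ => ?_
  ring

theorem one_sub_pow_mul_altDet_succ {N : ℕ} (x : Fin (N + 1) → R) (a : Fin (N + 1) → ℕ)
    (ha : Antitone a) :
    (1 - x (Fin.last N)) ^ N * altDet x a = (1 - x (Fin.last N)) ^ N *
      (x (Fin.last N) ^ a (Fin.last N) * ((∏ i : Fin N, (x i.castSucc - x (Fin.last N))) *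
        ∑ b ∈ Fintype.piFinset fun i : Fin N => Icc (a i.succ) (a i.castSucc),
          (∏ i, branchWeight (x (Fin.last N)) (a i.castSucc) (a i.succ) (b i)) *
            altDet (x ∘ Fin.castSucc) b)) := by
  set y := x (Fin.last N) with hy
  set M : Matrix (Fin (N + 1)) (Fin (N + 1)) R :=
    Matrix.of fun j i => x i ^ (a j + (N + 1 - 1 - j)) * (1 - x i) ^ (j : ℕ) with hM
  set U : Matrix (Fin (N + 1)) (Fin (N + 1)) R := Matrix.of (Fin.lastCases
    (fun k => if k = Fin.last N then 1 else 0)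
    (fun j k => if k = j.castSucc then 1 - y else
      if k = j.succ then - y ^ (a j.castSucc - a j.succ + 1) else 0)) with hU
  have hUdet : U.det = (1 - y) ^ N := by
    rw [Matrix.det_of_isUpperTriangular, Fin.prod_univ_castSucc]
    · simp [hU]
    · intro j k hjk
      have hjk : k < j := hjk
      simp only [hU, Matrix.of_apply]
      induction j using Fin.lastCases with
      | last => simp [hjk.ne]
      | cast j =>
        have : k ≠ j.succ := by
          rintro rfl
          exact absurd hjk (by simp [Fin.lt_def])
        simp [hjk.ne, this]
  have hlast : ∀ i, (U * M) (Fin.last N) i = M (Fin.last N) i := by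
    intro i
    simp [Matrix.mul_apply, hU]
  have hcast : ∀ j i, (U * M) (Fin.castSucc j) i =
      x i ^ (N - 1 - (j : ℕ)) * (1 - x i) ^ (j : ℕ) *
        ((1 - y) * x i ^ (a j.castSucc + 1) -
          (1 - x i) * (x i ^ a j.succ * y ^ (a j.castSucc - a j.succ + 1))) := by
    intro j i
    have hne : j.castSucc ≠ j.succ := by simp [Fin.ext_iff]
    rw [Matrix.mul_apply, Finset.sum_eq_add j.castSucc j.succ hne]
    · have h1 : N - (j : ℕ) = N - 1 - j + 1 := by omega
      have h2 : N - ((j : ℕ) + 1) = N - 1 - j := by omega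
      simp [hU, hM, hne.symm, h1, h2]
      ring
    · intro k _ hk
      simp [hU, hk]
    · simp
    · simp
  change (1 - y) ^ N * M.det = _
  rw [← hUdet, ← Matrix.det_mul, hUdet, Matrix.det_succ_column _ (Fin.last N),
    Fin.sum_univ_castSucc]
  have hz : ∀ j : Fin N, (U * M) j.castSucc (Fin.last N) = 0 := by
    intro j
    rw [hcast, ← hy]
    have := ha (Fin.castSucc_le_succ j)
    have : y ^ (a j.castSucc + 1) = y ^ a j.succ * y ^ (a j.castSucc - a j.succ + 1) := by
      rw [← pow_add]; congr 1; omega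
    rw [this]; ring
  simp only [hz, mul_zero, zero_mul, Finset.sum_const_zero, zero_add, hlast]
  have hsub : ((U * M).submatrix (Fin.last N).succAbove (Fin.last N).succAbove).det =
    (∏ i : Fin N, (x i.castSucc - y)) *
        ∑ b ∈ Fintype.piFinset fun i : Fin N => Icc (a i.succ) (a i.castSucc),
          (∏ i, branchWeight y (a i.castSucc) (a i.succ) (b i)) *
            altDet (x ∘ Fin.castSucc) b := by
    refine Eq.trans ?_ (sum_prod_branchWeight_mul_altDet (x ∘ Fin.castSucc) y a ha).symm
    congr 1
    ext j i
    simp [hcast]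
  rw [hsub]
  simp [hM, ← hy, ← two_mul]
  ring

theorem altDet_succ {N : ℕ} (x : Fin (N + 1) → R) (a : Fin (N + 1) → ℕ) (ha : Antitone a) :
    altDet x a = x (Fin.last N) ^ a (Fin.last N) *
      ((∏ i : Fin N, (x i.castSucc - x (Fin.last N))) *
        ∑ b ∈ Fintype.piFinset fun i : Fin N => Icc (a i.succ) (a i.castSucc),
          (∏ i, branchWeight (x (Fin.last N)) (a i.castSucc) (a i.succ) (b i)) *
            altDet (x ∘ Fin.castSucc) b) := by
  have key := one_sub_pow_mul_altDet_succ
    (MvPolynomial.X : Fin (N + 1) → MvPolynomial (Fin (N + 1)) ℤ) a ha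
  have hne : (1 - MvPolynomial.X (Fin.last N) : MvPolynomial (Fin (N + 1)) ℤ) ^ N ≠ 0 := by
    refine pow_ne_zero _ fun h => ?_
    have := congrArg (MvPolynomial.eval 0) h
    simp at this
  have key := congrArg (MvPolynomial.eval₂Hom (Int.castRingHom R) x) (mul_left_cancel₀ hne key)
  have hX : (MvPolynomial.eval₂Hom (Int.castRingHom R) x) ∘ MvPolynomial.X = x := by
    ext i; simp
  simp only [map_altDet, map_mul, map_pow, map_sum, map_prod, map_branchWeight, map_sub,
    ← Function.comp_assoc, hX] at key
  simpa using key

theorem altDet_zero_succ {N : ℕ} (x : Fin (N + 1) → R) :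
    altDet x 0 = (∏ i : Fin N, (x i.castSucc - x (Fin.last N))) * altDet (x ∘ Fin.castSucc) 0 := by
  rw [altDet_succ x 0 antitone_const]
  have : (Fintype.piFinset fun i : Fin N => Icc ((0 : Fin (N + 1) → ℕ) i.succ)
      ((0 : Fin (N + 1) → ℕ) i.castSucc)) = {0} := by
    ext b
    simp [funext_iff]
  rw [this]
  simp [branchWeight]

theorem antitone_of_mem_piFinset {N : ℕ} {a : Fin (N + 1) → ℕ} {b : Fin N → ℕ}
    (hb : b ∈ Fintype.piFinset fun i : Fin N => Icc (a i.succ) (a i.castSucc)) (ha : Antitone a) :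
    Antitone b := by
  intro i j hij
  simp only [Fintype.mem_piFinset, mem_Icc] at hb
  rcases hij.eq_or_lt with rfl | h
  · rfl
  · exact (hb j).2.trans ((ha (by simpa [Fin.le_def] using h)).trans (hb i).1)

/-- The bialternant formula. -/
theorem altDet_zero_mul_grothPoly {N : ℕ} (x : Fin N → R) (a : Fin N → ℕ) (ha : Antitone a) :
    altDet x 0 * grothPoly N x a = altDet x a := by
  induction N with
  | zero => simp [altDet, grothPoly]
  | succ N ih =>
    rw [altDet_succ x a ha, altDet_zero_succ, grothPoly]
    rw [mul_left_comm, mul_assoc, Finset.mul_sum]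
    congr 2
    refine Finset.sum_congr rfl fun b hb => ?_
    rw [← ih (x ∘ Fin.castSucc) b (antitone_of_mem_piFinset hb ha)]
    ring

theorem altDet_zero_ne_zero [IsDomain R] {N : ℕ} (x : Fin N → R) (hx : Function.Injective x) :
    altDet x 0 ≠ 0 := by
  induction N with
  | zero => simp [altDet]
  | succ N ih =>
    rw [altDet_zero_succ]
    refine mul_ne_zero (Finset.prod_ne_zero_iff.mpr fun i _ => sub_ne_zero.mpr fun h => ?_)
      (ih _ (hx.comp (Fin.castSucc_injective N)))
    exact (Fin.castSucc_lt_last i).ne (hx h)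

theorem altDet_zero_smul {N : ℕ} (t : R) (x : Fin N → R) :
    altDet (fun i => t * x i) 0 = t ^ (N.choose 2) * altDet x 0 := by
  induction N with
  | zero => simp [altDet]
  | succ N ih =>
    rw [altDet_zero_succ, altDet_zero_succ x]
    have := ih (x ∘ Fin.castSucc)
    simp only [Function.comp_def] at this ⊢
    rw [this, Nat.choose_succ_succ]
    simp only [← mul_sub, Finset.prod_mul_distrib, Finset.prod_const, Finset.card_univ,
      Fintype.card_fin, Nat.choose_one_right]
    ring

theorem grothPoly_comp_perm [IsDomain R] {N : ℕ} (x : Fin N → R) (hx : Function.Injective x)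
    (a : Fin N → ℕ) (ha : Antitone a) (σ : Equiv.Perm (Fin N)) :
    grothPoly N (x ∘ σ) a = grothPoly N x a := by
  have h1 := altDet_zero_mul_grothPoly (x ∘ σ) a ha
  rw [altDet_comp_perm, altDet_comp_perm, ← altDet_zero_mul_grothPoly x a ha, mul_assoc] at h1
  have hs : ((Equiv.Perm.sign σ : ℤ) : R) ≠ 0 := by
    rcases Int.units_eq_one_or (Equiv.Perm.sign σ) with h | h <;> simp [h]
  exact mul_left_cancel₀ (altDet_zero_ne_zero x hx) (mul_left_cancel₀ hs h1)

/-- Setting the last variable to zero drops it, or kills partitions with that many parts. -/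
theorem grothPoly_succ_of_last_eq_zero {N : ℕ} (x : Fin (N + 1) → R) (hx : x (Fin.last N) = 0)
    (a : Fin (N + 1) → ℕ) (ha : Antitone a) (hl : a (Fin.last N) = 0) :
    grothPoly (N + 1) x a = grothPoly N (x ∘ Fin.castSucc) (a ∘ Fin.castSucc) := by
  rw [grothPoly, hl, pow_zero, one_mul, hx,
    Finset.sum_eq_single (a ∘ Fin.castSucc)]
  · simp [branchWeight]
  · intro b hb hne
    obtain ⟨i, hi⟩ := Function.ne_iff.mp hne
    simp only [Fintype.mem_piFinset, mem_Icc] at hb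
    have := (hb i).2
    simp only [Function.comp_apply] at hi
    rw [Finset.prod_eq_zero (Finset.mem_univ i), zero_mul]
    rw [branchWeight, zero_pow (by omega), zero_mul]
  · intro h
    exfalso
    apply h
    simp only [Fintype.mem_piFinset, mem_Icc]
    exact fun i => ⟨ha (Fin.castSucc_le_succ i), le_rfl⟩

end Bialternant

theorem ext_rowLen {mu nu : YoungDiagram} (h : ∀ i, mu.rowLen i = nu.rowLen i) : mu = nu := by
  ext ⟨i, j⟩
  rw [YoungDiagram.mem_cells, YoungDiagram.mem_cells, YoungDiagram.mem_iff_lt_rowLen,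
    YoungDiagram.mem_iff_lt_rowLen, h]

theorem rowLen_mono {mu nu : YoungDiagram} (h : mu ≤ nu) (i : ℕ) : mu.rowLen i ≤ nu.rowLen i := by
  by_contra! hc
  exact lt_irrefl _ (YoungDiagram.mem_iff_lt_rowLen.mp (h (YoungDiagram.mem_iff_lt_rowLen.mpr hc)))

theorem rowLen_eq_of_mem_iff {mu : YoungDiagram} {i n : ℕ} (h : ∀ j, (i, j) ∈ mu ↔ j < n) :
    mu.rowLen i = n := by
  refine le_antisymm (not_lt.mp fun hc => ?_) (not_lt.mp fun hc => ?_)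
  · exact lt_irrefl _ ((h n).mp (YoungDiagram.mem_iff_lt_rowLen.mpr hc))
  · exact lt_irrefl _ (YoungDiagram.mem_iff_lt_rowLen.mp ((h _).mpr hc))

theorem card_eq_sum_rowLen (mu : YoungDiagram) {N : ℕ} (h : mu.rowLen N = 0) :
    mu.card = ∑ i : Fin N, mu.rowLen i := by
  rw [YoungDiagram.card, Finset.card_eq_sum_card_fiberwise (f := Prod.fst) (t := range N),
    Finset.sum_range]
  · refine Finset.sum_congr rfl fun i _ => ?_
    rw [YoungDiagram.rowLen_eq_card]
    rfl
  · rintro ⟨i, j⟩ hc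
    have hc : (i, j) ∈ mu := hc
    rw [YoungDiagram.mem_iff_lt_rowLen] at hc
    simp only [coe_range, Set.mem_Iio]
    by_contra! hi
    have := mu.rowLen_anti _ _ hi
    omega

/-- The first `N` parts of a partition. -/
def parts (N : ℕ) (mu : YoungDiagram) : Fin N → ℕ := fun i => mu.rowLen i

theorem parts_antitone (N : ℕ) (mu : YoungDiagram) : Antitone (parts N mu) :=
  fun _ _ h => mu.rowLen_anti _ _ h

/-- The Young diagram with rows `b`, for weakly decreasing `b`. -/
def ofParts {N : ℕ} (b : Fin N → ℕ) : YoungDiagram where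
  cells := (range N ×ˢ range (∑ i, b i)).filter fun c => ∀ i : Fin N, (i : ℕ) ≤ c.1 → c.2 < b i
  isLowerSet := by
    rintro ⟨i, j⟩ ⟨i', j'⟩ h hc
    obtain ⟨h1, h2⟩ := Prod.mk_le_mk.mp h
    simp only [Finset.coe_filter, Finset.mem_product, Finset.mem_range, Set.mem_ofPred_eq] at hc ⊢
    exact ⟨by omega, fun k hk => h2.trans_lt (hc.2 k (hk.trans h1))⟩

theorem mem_ofParts {N : ℕ} {b : Fin N → ℕ} (hb : Antitone b) {i j : ℕ} :
    (i, j) ∈ ofParts b ↔ ∃ h : i < N, j < b ⟨i, h⟩ := by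
  rw [← YoungDiagram.mem_cells]
  simp only [ofParts, mem_filter, mem_product, mem_range]
  constructor
  · rintro ⟨⟨h1, -⟩, h3⟩
    exact ⟨h1, h3 _ le_rfl⟩
  · rintro ⟨h1, h2⟩
    refine ⟨⟨h1, h2.trans_le (Finset.single_le_sum (fun _ _ => Nat.zero_le _) (mem_univ _))⟩,
      fun k hk => h2.trans_le (hb hk)⟩

theorem rowLen_ofParts {N : ℕ} {b : Fin N → ℕ} (hb : Antitone b) (i : Fin N) :
    (ofParts b).rowLen i = b i :=
  rowLen_eq_of_mem_iff fun j => by simp [mem_ofParts hb]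

theorem rowLen_ofParts_of_le {N : ℕ} {b : Fin N → ℕ} (hb : Antitone b) {i : ℕ} (hi : N ≤ i) :
    (ofParts b).rowLen i = 0 :=
  rowLen_eq_of_mem_iff fun j => by simp [mem_ofParts hb]; omega

theorem parts_ofParts {N : ℕ} {b : Fin N → ℕ} (hb : Antitone b) : parts N (ofParts b) = b :=
  funext fun i => rowLen_ofParts hb i

/-- The boxes of `lam` outside `mu`, and the last boxes of the rows of `mu` listed in `C`. -/
def IsTopBox (lam mu : YoungDiagram) {N : ℕ} (C : Finset (Fin N)) (i j : ℕ) : Prop :=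
  (i, j) ∈ lam ∧ ((i, j) ∉ mu ∨ ∃ k ∈ C, (k : ℕ) = i ∧ j + 1 = mu.rowLen i)

open Classical in
theorem card_isTopBox {lam mu : YoungDiagram} {N : ℕ} {C : Finset (Fin N)} (hle : mu ≤ lam)
    (hC : ∀ k ∈ C, 0 < mu.rowLen k) :
    (lam.cells.filter fun c => IsTopBox lam mu C c.1 c.2).card + mu.card = lam.card + C.card := by
  have h1 : (lam.cells.filter fun c => IsTopBox lam mu C c.1 c.2) =
      (lam.cells \ mu.cells) ∪ C.image fun k : Fin N => ((k : ℕ), mu.rowLen k - 1) := by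
    ext ⟨i, j⟩
    simp only [mem_filter, YoungDiagram.mem_cells, mem_union, mem_sdiff, mem_image, Prod.mk.injEq]
    simp only [IsTopBox]
    constructor
    · rintro ⟨-, h, h' | ⟨k, hk, rfl, h'⟩⟩
      · exact Or.inl ⟨h, h'⟩
      · exact Or.inr ⟨k, hk, rfl, by omega⟩
    · rintro (⟨h, h'⟩ | ⟨k, hk, rfl, rfl⟩)
      · exact ⟨h, h, Or.inl h'⟩
      · have := hC k hk
        have hm : ((k : ℕ), mu.rowLen k - 1) ∈ mu :=
          YoungDiagram.mem_iff_lt_rowLen.mpr (by omega)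
        exact ⟨hle hm, hle hm, Or.inr ⟨k, hk, rfl, by omega⟩⟩
  have h2 : Disjoint (lam.cells \ mu.cells) (C.image fun k : Fin N => ((k : ℕ), mu.rowLen k - 1)) := by
    rw [Finset.disjoint_left]
    rintro ⟨i, j⟩ h h'
    simp only [mem_sdiff, mem_image, Prod.mk.injEq] at h h'
    obtain ⟨k, hk, rfl, rfl⟩ := h'
    have := hC k hk
    exact h.2 (YoungDiagram.mem_iff_lt_rowLen.mpr (by omega))
  rw [h1, Finset.card_union_of_disjoint h2, Finset.card_image_of_injective,
    Finset.card_sdiff_of_subset (YoungDiagram.cells_subset_iff.mpr hle)]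
  · have := Finset.card_le_card (YoungDiagram.cells_subset_iff.mpr hle)
    simp only [YoungDiagram.card] at *
    omega
  · intro k l h
    exact Fin.ext (Prod.mk.inj h).1

namespace SetValuedTableau

variable {lam mu : YoungDiagram}

theorem ext_entry {T T' : SetValuedTableau mu} (h : ∀ i j, T.entry i j = T'.entry i j) :
    T = T' := by
  cases T; cases T'
  congr
  funext i j
  exact h i j

theorem mem_of_mem_entry (T : SetValuedTableau mu) {a i j : ℕ} (h : a ∈ T.entry i j) :
    (i, j) ∈ mu := by
  by_contra hc
  simp [T.empty_off hc] at h

theorem content_pos (T : SetValuedTableau mu) {a i j : ℕ} (h : a ∈ T.entry i j) :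
    0 < T.content a := by
  refine Finset.card_pos.mpr ⟨(i, j), ?_⟩
  simp only [mem_filter, YoungDiagram.mem_cells]
  exact ⟨T.mem_of_mem_entry h, h⟩

theorem le_of_mem_entry (T : SetValuedTableau mu) {a i j : ℕ} (h : a ∈ T.entry i j) : i ≤ a := by
  induction i generalizing a with
  | zero => exact Nat.zero_le a
  | succ i ih =>
    have hmem := T.mem_of_mem_entry h
    obtain ⟨b, hb⟩ := T.nonempty (mu.up_left_mem (Nat.le_succ i) le_rfl hmem)
    exact (ih hb).trans_lt (T.col_strict (Nat.lt_succ_self i) hmem b hb a h)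

theorem exists_lt_of_le (T : SetValuedTableau mu) {N i i' j j' : ℕ} (hi : i' ≤ i)
    (hj : j' ≤ j) (h : ∃ a ∈ T.entry i j, a < N) : ∃ a ∈ T.entry i' j', a < N := by
  obtain ⟨a, ha, haN⟩ := h
  have hmem := T.mem_of_mem_entry ha
  obtain ⟨b, hb, hbN⟩ : ∃ b ∈ T.entry i' j, b < N := by
    rcases hi.eq_or_lt with rfl | hi
    · exact ⟨a, ha, haN⟩
    · obtain ⟨b, hb⟩ := T.nonempty (mu.up_left_mem hi.le le_rfl hmem)
      exact ⟨b, hb, (T.col_strict hi hmem b hb a ha).trans haN⟩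
  rcases hj.eq_or_lt with rfl | hj
  · exact ⟨b, hb, hbN⟩
  · obtain ⟨c, hc⟩ := T.nonempty (mu.up_left_mem hi hj.le hmem)
    exact ⟨c, hc, (T.row_weak hj (T.mem_of_mem_entry hb) c hc b hb).trans_lt hbN⟩

/-- The shape formed by the boxes that contain a letter below `N`. -/
def lowerShape (T : SetValuedTableau mu) (N : ℕ) : YoungDiagram where
  cells := mu.cells.filter fun c => ∃ a ∈ T.entry c.1 c.2, a < N
  isLowerSet := by
    rintro ⟨i, j⟩ ⟨i', j'⟩ h hc
    obtain ⟨h1, h2⟩ := Prod.mk_le_mk.mp h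
    simp only [Finset.coe_filter, Set.mem_ofPred_eq, YoungDiagram.mem_cells] at hc ⊢
    exact ⟨mu.up_left_mem h1 h2 hc.1, T.exists_lt_of_le h1 h2 hc.2⟩

theorem mem_lowerShape {T : SetValuedTableau mu} {N i j : ℕ} :
    (i, j) ∈ T.lowerShape N ↔ ∃ a ∈ T.entry i j, a < N := by
  rw [← YoungDiagram.mem_cells]
  simp only [lowerShape, mem_filter, YoungDiagram.mem_cells, and_iff_right_iff_imp]
  rintro ⟨a, ha, -⟩
  exact T.mem_of_mem_entry ha

theorem lowerShape_le (T : SetValuedTableau mu) (N : ℕ) : T.lowerShape N ≤ mu := by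
  rintro ⟨i, j⟩ h
  obtain ⟨a, ha, -⟩ := mem_lowerShape.mp h
  exact T.mem_of_mem_entry ha

theorem rowLen_lowerShape (T : SetValuedTableau mu) (N : ℕ) : (T.lowerShape N).rowLen N = 0 :=
  rowLen_eq_of_mem_iff fun j => by
    rw [mem_lowerShape]
    simp only [not_lt_zero, iff_false, not_exists, not_and, not_lt]
    exact fun a ha => T.le_of_mem_entry ha

/-- The rows of the shape of letters below `N` whose last box also contains `N`. -/
def topCorners (T : SetValuedTableau mu) (N : ℕ) : Finset (Fin N) :=
  univ.filter fun k => mu.rowLen (k + 1) < (T.lowerShape N).rowLen k ∧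
    N ∈ T.entry k ((T.lowerShape N).rowLen k - 1)

theorem rowLen_succ_le_rowLen_lowerShape (T : SetValuedTableau mu) {N : ℕ}
    (hT : ∀ a i j, a ∈ T.entry i j → a ≤ N) (i : ℕ) :
    mu.rowLen (i + 1) ≤ (T.lowerShape N).rowLen i := by
  by_contra! hc
  have h1 : (i + 1, (T.lowerShape N).rowLen i) ∈ mu := YoungDiagram.mem_iff_lt_rowLen.mpr hc
  obtain ⟨a, ha⟩ := T.nonempty (mu.up_left_mem (Nat.le_succ i) le_rfl h1)
  obtain ⟨b, hb⟩ := T.nonempty h1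
  have h2 : (i, (T.lowerShape N).rowLen i) ∈ T.lowerShape N :=
    mem_lowerShape.mpr ⟨a, ha, (T.col_strict (Nat.lt_succ_self i) h1 a ha b hb).trans_le
      (hT _ _ _ hb)⟩
  exact lt_irrefl _ (YoungDiagram.mem_iff_lt_rowLen.mp h2)

theorem mem_entry_iff_isTopBox (T : SetValuedTableau mu) {N : ℕ}
    (hT : ∀ a i j, a ∈ T.entry i j → a ≤ N) {i j : ℕ} :
    N ∈ T.entry i j ↔ IsTopBox mu (T.lowerShape N) (T.topCorners N) i j := by
  constructor
  · intro h
    refine ⟨T.mem_of_mem_entry h, or_iff_not_imp_left.mpr fun hmem => ?_⟩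
    rw [not_not] at hmem
    obtain ⟨a, ha, haN⟩ := mem_lowerShape.mp hmem
    have hi : i < N := (T.le_of_mem_entry ha).trans_lt haN
    have h1 : j + 1 = (T.lowerShape N).rowLen i := by
      refine le_antisymm (YoungDiagram.mem_iff_lt_rowLen.mp hmem) ?_
      by_contra! hc
      obtain ⟨b, hb, hbN⟩ := mem_lowerShape.mp (YoungDiagram.mem_iff_lt_rowLen.mpr hc)
      exact absurd (T.row_weak (Nat.lt_succ_self j) (T.mem_of_mem_entry hb) N h b hb) (by omega)
    refine ⟨⟨i, hi⟩, ?_, rfl, h1⟩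
    simp only [topCorners, mem_filter, mem_univ, true_and]
    rw [← h1]
    refine ⟨?_, by simpa using h⟩
    by_contra! hc
    have hm : (i + 1, j) ∈ mu := YoungDiagram.mem_iff_lt_rowLen.mpr (by omega)
    obtain ⟨b, hb⟩ := T.nonempty hm
    have := T.col_strict (Nat.lt_succ_self i) hm N h b hb
    have := hT _ _ _ hb
    omega
  · rintro ⟨hm, h | ⟨k, hk, rfl, h⟩⟩
    · obtain ⟨a, ha⟩ := T.nonempty hm
      rw [mem_lowerShape] at h
      push Not at h
      rwa [← le_antisymm (hT _ _ _ ha) (h a ha)]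
    · simp only [topCorners, mem_filter, mem_univ, true_and] at hk
      rw [← h] at hk
      simpa using hk.2

/-- Remove the letter `N` from a tableau with letters at most `N`. -/
def removeLetter (T : SetValuedTableau lam) {N : ℕ} (hT : ∀ a i j, a ∈ T.entry i j → a ≤ N)
    (h : T.lowerShape N = mu) : SetValuedTableau mu where
  entry i j := (T.entry i j).erase N
  nonempty {i j} hm := by
    rw [← h] at hm
    obtain ⟨a, ha, haN⟩ := mem_lowerShape.mp hm
    exact ⟨a, Finset.mem_erase.mpr ⟨haN.ne, ha⟩⟩
  row_weak hj hm a ha b hb := by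
    rw [← h] at hm
    exact T.row_weak hj (T.lowerShape_le N hm) a (Finset.mem_of_mem_erase ha) b
      (Finset.mem_of_mem_erase hb)
  col_strict hi hm a ha b hb := by
    rw [← h] at hm
    exact T.col_strict hi (T.lowerShape_le N hm) a (Finset.mem_of_mem_erase ha) b
      (Finset.mem_of_mem_erase hb)
  empty_off {i j} hm := by
    rw [← h, mem_lowerShape] at hm
    push Not at hm
    refine Finset.eq_empty_of_forall_notMem fun a ha => ?_
    obtain ⟨h1, h2⟩ := Finset.mem_erase.mp ha
    exact h1 (le_antisymm (hT _ _ _ h2) (hm a h2))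

open Classical in
/-- Add the letter `N` to a tableau with letters below `N`. -/
noncomputable def addLetter (T : SetValuedTableau mu) {N : ℕ} (C : Finset (Fin N))
    (hT : ∀ a i j, a ∈ T.entry i j → a < N) (hle : mu ≤ lam) (hN : lam.rowLen (N + 1) = 0)
    (hinter : ∀ i < N, lam.rowLen (i + 1) ≤ mu.rowLen i)
    (hC : ∀ k ∈ C, lam.rowLen (k + 1) < mu.rowLen k) : SetValuedTableau lam where
  entry i j := T.entry i j ∪ if IsTopBox lam mu C i j then {N} else ∅
  nonempty {i j} hm := by
    by_cases h : (i, j) ∈ mu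
    · exact (T.nonempty h).mono Finset.subset_union_left
    · rw [if_pos ⟨hm, Or.inl h⟩]
      exact ⟨N, by simp⟩
  row_weak {i j₁ j₂} hj hm a ha b hb := by
    simp only [mem_union] at ha hb
    rcases ha with ha | ha <;> rcases hb with hb | hb
    · exact T.row_weak hj (T.mem_of_mem_entry hb) a ha b hb
    · split_ifs at hb
      · rw [Finset.mem_singleton.mp hb]
        exact (hT _ _ _ ha).le
      · simp at hb
    · exfalso
      split_ifs at ha with h
      · have hb' := T.mem_of_mem_entry hb
        rcases h.2 with h' | ⟨k, -, rfl, h'⟩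
        · exact h' (mu.up_left_mem le_rfl hj.le hb')
        · rw [YoungDiagram.mem_iff_lt_rowLen] at hb'
          omega
      · simp at ha
    · split_ifs at ha hb <;> simp_all
  col_strict {i₁ i₂ j} hi hm a ha b hb := by
    simp only [mem_union] at ha hb
    have hm' := YoungDiagram.mem_iff_lt_rowLen.mp hm
    have hi1 := lam.rowLen_anti (i₁ + 1) i₂ hi
    rcases ha with ha | ha
    · rcases hb with hb | hb
      · exact T.col_strict hi (T.mem_of_mem_entry hb) a ha b hb
      · split_ifs at hb
        · rw [Finset.mem_singleton.mp hb]
          exact hT _ _ _ ha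
        · simp at hb
    · exfalso
      split_ifs at ha with h
      · rcases h.2 with h' | ⟨k, hk, rfl, h'⟩
        · have hiN : i₁ < N := by
            by_contra! hc
            have := lam.rowLen_anti (N + 1) i₂ (by omega)
            omega
          have := hinter i₁ hiN
          exact h' (YoungDiagram.mem_iff_lt_rowLen.mpr (by omega))
        · have := hC k hk
          omega
      · simp at ha
  empty_off {i j} hm := by
    rw [T.empty_off fun h => hm (hle h), if_neg fun h => hm h.1]
    rfl

theorem le_of_content {T : SetValuedTableau mu} {m : ℕ →₀ ℕ} (h : ∀ k, T.content k = m k) {N : ℕ}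
    (hm : ∀ k, N < k → m k = 0) : ∀ a i j, a ∈ T.entry i j → a ≤ N := by
  intro a i j ha
  by_contra! hc
  have := T.content_pos ha
  rw [h, hm _ hc] at this
  omega

open Classical in
theorem content_add_card_lowerShape (T : SetValuedTableau lam) {N : ℕ}
    (hT : ∀ a i j, a ∈ T.entry i j → a ≤ N) :
    T.content N + (T.lowerShape N).card = lam.card + (T.topCorners N).card := by
  rw [← card_isTopBox (T.lowerShape_le N)
    (C := T.topCorners N) (N := N)]
  · rw [content]
    congr 2
    ext c
    simp only [mem_filter, T.mem_entry_iff_isTopBox hT]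
  · intro k hk
    simp only [topCorners, mem_filter, mem_univ, true_and] at hk
    omega

theorem content_removeLetter (T : SetValuedTableau lam) {N : ℕ}
    (hT : ∀ a i j, a ∈ T.entry i j → a ≤ N) (h : T.lowerShape N = mu) (k : ℕ) :
    (T.removeLetter hT h).content k = if k = N then 0 else T.content k := by
  split_ifs with hk
  · subst hk
    simp [content, removeLetter]
  · rw [content, content]
    congr 1
    ext ⟨i, j⟩
    simp only [removeLetter, mem_filter, YoungDiagram.mem_cells, Finset.mem_erase]
    constructor
    · rintro ⟨-, -, h2⟩
      exact ⟨T.mem_of_mem_entry h2, h2⟩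
    · rintro ⟨-, h2⟩
      refine ⟨?_, hk, h2⟩
      rw [← h, mem_lowerShape]
      exact ⟨k, h2, lt_of_le_of_ne (hT _ _ _ h2) hk⟩

section AddLetter

variable (T : SetValuedTableau mu) {N : ℕ} (C : Finset (Fin N))
    (hT : ∀ a i j, a ∈ T.entry i j → a < N) (hle : mu ≤ lam) (hN : lam.rowLen (N + 1) = 0)
    (hinter : ∀ i < N, lam.rowLen (i + 1) ≤ mu.rowLen i)
    (hC : ∀ k ∈ C, lam.rowLen (k + 1) < mu.rowLen k)

theorem mem_entry_addLetter {a i j : ℕ} :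
    a ∈ (T.addLetter C hT hle hN hinter hC).entry i j ↔
      a ∈ T.entry i j ∨ (a = N ∧ IsTopBox lam mu C i j) := by
  simp only [addLetter, mem_union]
  split_ifs with h <;> simp [h]

theorem lowerShape_addLetter : (T.addLetter C hT hle hN hinter hC).lowerShape N = mu := by
  ext ⟨i, j⟩
  rw [YoungDiagram.mem_cells, YoungDiagram.mem_cells, mem_lowerShape]
  constructor
  · rintro ⟨a, ha, haN⟩
    rw [mem_entry_addLetter] at ha
    rcases ha with ha | ⟨rfl, -⟩
    · exact T.mem_of_mem_entry ha
    · omega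
  · intro h
    obtain ⟨a, ha⟩ := T.nonempty h
    exact ⟨a, (T.mem_entry_addLetter C hT hle hN hinter hC).mpr (Or.inl ha), hT _ _ _ ha⟩

theorem topCorners_addLetter : (T.addLetter C hT hle hN hinter hC).topCorners N = C := by
  ext k
  simp only [topCorners, mem_filter, mem_univ, true_and, lowerShape_addLetter,
    mem_entry_addLetter]
  constructor
  · rintro ⟨h1, h | h⟩
    · exact absurd (hT _ _ _ h) (lt_irrefl _)
    · rcases h.2 with h | ⟨l, hl, h2, -⟩
      · exact absurd (YoungDiagram.mem_iff_lt_rowLen.mpr (by omega)) h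
      · rwa [← Fin.ext h2]
  · intro hk
    have := hC k hk
    refine ⟨this, Or.inr ⟨hle ?_, Or.inr ⟨k, hk, rfl, by omega⟩⟩⟩
    exact YoungDiagram.mem_iff_lt_rowLen.mpr (by omega)

theorem content_addLetter_of_ne {k : ℕ} (hk : k ≠ N) :
    (T.addLetter C hT hle hN hinter hC).content k = T.content k := by
  rw [content, content]
  congr 1
  ext ⟨i, j⟩
  simp only [mem_filter, YoungDiagram.mem_cells, mem_entry_addLetter, hk, false_and, or_false]
  exact ⟨fun h => ⟨T.mem_of_mem_entry h.2, h.2⟩, fun h => ⟨hle h.1, h.2⟩⟩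

end AddLetter

/-- Tableaux with prescribed content, shape of the letters below `N` and corners containing `N`
correspond to tableaux in the smaller letters. -/
noncomputable def fiberEquiv {N : ℕ} (m : ℕ →₀ ℕ) (C : Finset (Fin N))
    (hm : ∀ k, N < k → m k = 0) (hle : mu ≤ lam) (hN : lam.rowLen (N + 1) = 0)
    (hinter : ∀ i < N, lam.rowLen (i + 1) ≤ mu.rowLen i)
    (hC : ∀ k ∈ C, lam.rowLen (k + 1) < mu.rowLen k)
    (hcard : m N + mu.card = lam.card + C.card) :
    {T : {T : SetValuedTableau lam // ∀ k, T.content k = m k} //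
      T.1.lowerShape N = mu ∧ T.1.topCorners N = C} ≃
    {T : SetValuedTableau mu // ∀ k, T.content k = m.erase N k} where
  toFun T := ⟨T.1.1.removeLetter (le_of_content T.1.2 hm) T.2.1, fun k => by
    rw [content_removeLetter, Finsupp.erase_apply, T.1.2 k]⟩
  invFun T :=
    have hT : ∀ a i j, a ∈ T.1.entry i j → a < N := fun a i j ha => by
      have h := T.1.content_pos ha
      rw [T.2, Finsupp.erase_apply] at h
      split_ifs at h with h1
      · omega
      · by_contra! hc
        rw [hm a (lt_of_le_of_ne hc (Ne.symm h1))] at h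
        omega
    ⟨⟨T.1.addLetter C hT hle hN hinter hC, fun k => by
      by_cases hk : k = N
      · subst hk
        have h1 := content_add_card_lowerShape (T.1.addLetter C hT hle hN hinter hC) (N := k)
          (fun a i j ha => by
            rw [mem_entry_addLetter] at ha
            rcases ha with ha | ha
            · exact (hT _ _ _ ha).le
            · exact ha.1.le)
        rw [lowerShape_addLetter, topCorners_addLetter] at h1
        omega
      · rw [content_addLetter_of_ne _ _ _ _ _ _ _ hk, T.2, Finsupp.erase_ne hk]⟩,
      lowerShape_addLetter _ _ hT hle hN hinter hC, topCorners_addLetter _ _ hT hle hN hinter hC⟩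
  left_inv T := by
    refine Subtype.ext (Subtype.ext (ext_entry fun i j => ?_))
    ext a
    rw [mem_entry_addLetter]
    simp only [removeLetter, Finset.mem_erase]
    have h := T.1.1.mem_entry_iff_isTopBox (le_of_content T.1.2 hm) (i := i) (j := j)
    rw [T.2.1, T.2.2] at h
    rw [← h]
    by_cases ha : a = N <;> simp [ha]
  right_inv T := by
    refine Subtype.ext (ext_entry fun i j => ?_)
    ext a
    simp only [removeLetter, Finset.mem_erase, mem_entry_addLetter]
    constructor
    · rintro ⟨h1, h | h⟩
      · exact h
      · exact absurd h.1 h1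
    · intro h
      refine ⟨?_, Or.inl h⟩
      rintro rfl
      have := T.1.content_pos h
      rw [T.2] at this
      simp at this

instance finite_content (mu : YoungDiagram) (m : ℕ →₀ ℕ) :
    Finite {T : SetValuedTableau mu // ∀ k, T.content k = m k} := by
  let f : {T : SetValuedTableau mu // ∀ k, T.content k = m k} →
      (mu.cells → m.support.powerset) := fun T c =>
    ⟨T.1.entry c.1.1 c.1.2, by
      rw [Finset.mem_powerset]
      intro a ha
      have := T.1.content_pos ha
      rw [T.2] at this
      exact Finsupp.mem_support_iff.mpr (by omega)⟩
  refine Finite.of_injective f fun T T' h => Subtype.ext (ext_entry fun i j => ?_)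
  by_cases hm : (i, j) ∈ mu
  · exact congrArg Subtype.val (congrFun h ⟨(i, j), hm⟩)
  · rw [T.1.empty_off hm, T'.1.empty_off hm]

end SetValuedTableau

/-- The number of set-valued tableaux of shape `mu` and content `m`. -/
noncomputable def tableauCount (mu : YoungDiagram) (m : ℕ →₀ ℕ) : ℕ :=
  Nat.card {T : SetValuedTableau mu // ∀ k, T.content k = m k}

theorem coeff_stableG (mu : YoungDiagram) (m : ℕ →₀ ℕ) : MvPowerSeries.coeff m (stableG mu) =
    (-1 : ℂ) ^ ((m.degree : ℤ) - (mu.card : ℤ)) * (tableauCount mu m : ℂ) := rfl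

theorem tableauCount_eq_zero {mu : YoungDiagram} {m : ℕ →₀ ℕ}
    (h : ∀ T : SetValuedTableau mu, ¬ ∀ k, T.content k = m k) : tableauCount mu m = 0 := by
  have : IsEmpty {T : SetValuedTableau mu // ∀ k, T.content k = m k} := ⟨fun T => h T.1 T.2⟩
  exact Nat.card_of_isEmpty

theorem ofParts_le {N : ℕ} {lam : YoungDiagram} {b : Fin N → ℕ} (hb : Antitone b)
    (h : ∀ i, b i ≤ lam.rowLen i) : ofParts b ≤ lam := by
  rintro ⟨i, j⟩ hm
  obtain ⟨hi, hj⟩ := (mem_ofParts hb).mp hm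
  exact YoungDiagram.mem_iff_lt_rowLen.mpr (hj.trans_le (h ⟨i, hi⟩))

theorem card_ofParts {N : ℕ} {b : Fin N → ℕ} (hb : Antitone b) : (ofParts b).card = ∑ i, b i := by
  rw [card_eq_sum_rowLen _ (rowLen_ofParts_of_le hb le_rfl)]
  exact Finset.sum_congr rfl fun i _ => rowLen_ofParts hb i

/-- The branching rule for set-valued tableaux. -/
theorem tableauCount_succ {lam : YoungDiagram} {N : ℕ} {m : ℕ →₀ ℕ}
    (hN : lam.rowLen (N + 1) = 0) (hm : ∀ k, N < k → m k = 0) :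
    tableauCount lam m =
      ∑ b ∈ Fintype.piFinset fun i : Fin N =>
          Icc (parts (N + 1) lam i.succ) (parts (N + 1) lam i.castSucc),
        ∑ C ∈ (univ.filter fun i : Fin N => parts (N + 1) lam i.succ < b i).powerset,
          if m N + ∑ i, b i = lam.card + C.card then tableauCount (ofParts b) (m.erase N)
          else 0 := by
  classical
  have hanti : ∀ b ∈ Fintype.piFinset fun i : Fin N =>
      Icc (parts (N + 1) lam i.succ) (parts (N + 1) lam i.castSucc), Antitone b :=
    fun b hb => antitone_of_mem_piFinset hb (parts_antitone _ _)
  rw [Finset.sum_sigma', ← Finset.sum_filter]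
  set I := (((Fintype.piFinset fun i : Fin N =>
      Icc (parts (N + 1) lam i.succ) (parts (N + 1) lam i.castSucc)).sigma fun b =>
      (univ.filter fun i : Fin N => parts (N + 1) lam i.succ < b i).powerset).filter fun p =>
        m N + ∑ i, p.1 i = lam.card + p.2.card) with hI
  have hf : ∀ T : {T : SetValuedTableau lam // ∀ k, T.content k = m k},
      (⟨parts N (T.1.lowerShape N), T.1.topCorners N⟩ : Σ _ : Fin N → ℕ, Finset (Fin N)) ∈ I := by
    intro T
    have hT := SetValuedTableau.le_of_content T.2 hm
    simp only [hI, mem_filter, mem_sigma, Fintype.mem_piFinset, mem_Icc, mem_powerset]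
    refine ⟨⟨fun i => ⟨?_, ?_⟩, ?_⟩, ?_⟩
    · exact T.1.rowLen_succ_le_rowLen_lowerShape hT i
    · exact rowLen_mono (T.1.lowerShape_le N) i
    · intro k hk
      simp only [SetValuedTableau.topCorners, mem_filter, mem_univ, true_and] at hk ⊢
      exact hk.1
    · have h1 := T.1.content_add_card_lowerShape hT
      rw [T.2, card_eq_sum_rowLen _ (T.1.rowLen_lowerShape N)] at h1
      exact h1
  let f : {T : SetValuedTableau lam // ∀ k, T.content k = m k} → I := fun T => ⟨_, hf T⟩
  rw [← Finset.sum_coe_sort, tableauCount, ← Nat.card_congr (Equiv.sigmaFiberEquiv f),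
    Nat.card_sigma]
  refine Finset.sum_congr rfl fun p _ => ?_
  obtain ⟨⟨b, C⟩, hp⟩ := p
  have hp' := hp
  simp only [hI, mem_filter, mem_sigma, mem_powerset] at hp'
  obtain ⟨⟨hb, hC⟩, hcard⟩ := hp'
  have hba := hanti b hb
  simp only [Fintype.mem_piFinset, mem_Icc] at hb
  rw [tableauCount, ← Nat.card_congr (SetValuedTableau.fiberEquiv (lam := lam) (mu := ofParts b)
    m C hm (ofParts_le hba fun i => (hb i).2) hN ?_ ?_ ?_)]
  · refine Nat.card_congr (Equiv.subtypeEquivRight fun T => ?_)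
    simp only [f, Subtype.mk.injEq, Sigma.mk.injEq, heq_eq_eq]
    refine and_congr_left fun _ => ⟨?_, ?_⟩
    · rintro rfl
      refine ext_rowLen fun i => ?_
      rcases lt_or_ge i N with h | h
      · exact (rowLen_ofParts hba ⟨i, h⟩).symm
      · rw [rowLen_ofParts_of_le hba h]
        have h1 := T.1.rowLen_lowerShape N
        have h2 := (T.1.lowerShape N).rowLen_anti _ _ h
        omega
    · intro h
      rw [h, parts_ofParts hba]
  · intro i hi
    exact (hb ⟨i, hi⟩).1.trans_eq (rowLen_ofParts hba ⟨i, hi⟩).symm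
  · intro k hk
    have := hC hk
    simp only [mem_filter, mem_univ, true_and] at this
    rw [rowLen_ofParts hba]
    exact this
  · rw [card_ofParts hba]
    exact hcard

theorem grothPoly_X_eq_rename {N : ℕ} (a : Fin N → ℕ) :
    grothPoly N (fun i : Fin N => (MvPolynomial.X (i : ℕ) : MvPolynomial ℕ ℂ)) a =
      MvPolynomial.rename Fin.val (grothPoly N (MvPolynomial.X : Fin N → MvPolynomial _ ℂ) a) := by
  have := map_grothPoly (MvPolynomial.rename (R := ℂ) (Fin.val : Fin N → ℕ)).toRingHom
    MvPolynomial.X a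
  refine Eq.trans ?_ this.symm
  congr 1
  ext i : 1
  simp

theorem coeff_grothPoly_eq_zero {N : ℕ} (a : Fin N → ℕ) {m : ℕ →₀ ℕ} {k : ℕ} (hk : N ≤ k)
    (hm : m k ≠ 0) :
    (grothPoly N (fun i : Fin N => (MvPolynomial.X (i : ℕ) : MvPolynomial ℕ ℂ)) a).coeff m = 0 := by
  rw [grothPoly_X_eq_rename]
  refine MvPolynomial.coeff_rename_eq_zero _ _ _ fun u hu => ?_
  exfalso
  apply hm
  rw [← hu, Finsupp.mapDomain_of_notMem_range]
  rintro ⟨i, rfl⟩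
  omega

theorem coeff_X_pow_mul_of_notMem {p : MvPolynomial ℕ ℂ} {N : ℕ}
    (hp : ∀ m : ℕ →₀ ℕ, m N ≠ 0 → p.coeff m = 0) (k : ℕ) (m : ℕ →₀ ℕ) :
    (MvPolynomial.X N ^ k * p).coeff m = if m N = k then p.coeff (m.erase N) else 0 := by
  rw [MvPolynomial.X_pow_eq_monomial, MvPolynomial.coeff_monomial_mul', one_mul]
  by_cases h : m N = k
  · rw [if_pos h, if_pos (by rw [Finsupp.single_le_iff]; exact h.ge), ← Finsupp.erase_add_single N m,
      h]
    simp
  · rw [if_neg h]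
    split_ifs with h1
    · rw [Finsupp.single_le_iff] at h1
      refine hp _ ?_
      simp only [Finsupp.tsub_apply, Finsupp.single_eq_same]
      omega
    · rfl

theorem prod_branchWeight_eq_sum {R : Type*} [CommRing R] {N : ℕ} (y : R) (a : Fin (N + 1) → ℕ)
    (b : Fin N → ℕ) :
    ∏ i, branchWeight y (a i.castSucc) (a i.succ) (b i) =
      ∑ C ∈ (univ.filter fun i : Fin N => a i.succ < b i).powerset,
        (-1) ^ C.card * y ^ (∑ i : Fin N, (a i.castSucc - b i) + C.card) := by
  simp only [branchWeight]
  rw [Finset.prod_mul_distrib, Finset.prod_pow_eq_pow_sum, ← Finset.prod_filter, Finset.prod_sub,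
    Finset.mul_sum]
  refine Finset.sum_congr rfl fun C _ => ?_
  simp only [prod_const_one, mul_one, prod_const]
  ring

/-- `grothPoly` is the restriction of `stableG` to finitely many variables. -/
theorem coeff_grothPoly {N : ℕ} {lam : YoungDiagram} (hN : lam.rowLen N = 0) {m : ℕ →₀ ℕ}
    (hm : ∀ k, N ≤ k → m k = 0) :
    (grothPoly N (fun i : Fin N => (MvPolynomial.X (i : ℕ) : MvPolynomial ℕ ℂ))
      (parts N lam)).coeff m = MvPowerSeries.coeff m (stableG lam) := by
  induction N generalizing lam m with
  | zero =>
    have hm0 : m = 0 := Finsupp.ext fun k => hm k (Nat.zero_le k)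
    have hlam : ∀ i j, (i, j) ∉ lam := by
      intro i j h
      have h1 := YoungDiagram.mem_iff_lt_rowLen.mp h
      have h2 := lam.rowLen_anti 0 i (Nat.zero_le i)
      omega
    have hcard : lam.card = 0 := by
      rw [card_eq_sum_rowLen lam hN]; rfl
    have h1 : tableauCount lam m = 1 := by
      rw [tableauCount, Nat.card_eq_one_iff_unique]
      refine ⟨⟨fun T T' => Subtype.ext (SetValuedTableau.ext_entry fun i j => ?_)⟩, ⟨⟨⟨fun _ _ => ∅,
        fun h => absurd h (hlam _ _), by simp, by simp, by simp⟩, fun k => ?_⟩⟩⟩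
      · rw [T.1.empty_off (hlam i j), T'.1.empty_off (hlam i j)]
      · simp [SetValuedTableau.content, hm0]
    rw [coeff_stableG, h1, hcard, hm0]
    simp [grothPoly]
  | succ N ih =>
    have hsupp : ∀ (b : Fin N → ℕ) (m : ℕ →₀ ℕ), m N ≠ 0 →
        (grothPoly N (fun i : Fin N => (MvPolynomial.X (i : ℕ) : MvPolynomial ℕ ℂ)) b).coeff m
          = 0 := fun b m => coeff_grothPoly_eq_zero b le_rfl
    rw [coeff_stableG, tableauCount_succ hN fun k hk => hm k hk, grothPoly]
    push_cast
    simp only [Finset.mul_sum, MvPolynomial.coeff_sum, prod_branchWeight_eq_sum, Finset.sum_mul]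
    refine Finset.sum_congr rfl fun b hb => ?_
    have hba := antitone_of_mem_piFinset hb (parts_antitone (N + 1) lam)
    simp only [Fintype.mem_piFinset, mem_Icc] at hb
    refine Finset.sum_congr rfl fun C _ => ?_
    have hcard : lam.card = ∑ i : Fin N, (parts (N + 1) lam i.castSucc - b i) +
        parts (N + 1) lam (Fin.last N) + ∑ i, b i := by
      rw [card_eq_sum_rowLen lam hN, Fin.sum_univ_castSucc, add_right_comm,
        ← Finset.sum_add_distrib]
      congr 1
      exact Finset.sum_congr rfl fun i _ => (Nat.sub_add_cancel (hb i).2).symm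
    have hcomp : (fun i : Fin (N + 1) => (MvPolynomial.X (i : ℕ) : MvPolynomial ℕ ℂ)) ∘
        Fin.castSucc = fun i : Fin N => MvPolynomial.X (i : ℕ) := rfl
    rw [hcomp]
    have hrw : ∀ (P : MvPolynomial ℕ ℂ) (u v c : ℕ),
        (MvPolynomial.X N ^ u * ((-1) ^ c * MvPolynomial.X N ^ v * P) : MvPolynomial ℕ ℂ) =
          MvPolynomial.C ((-1) ^ c) * (MvPolynomial.X N ^ (u + v) * P) := by
      intro P u v c
      rw [map_pow, map_neg, map_one]
      ring
    rw [hrw, MvPolynomial.coeff_C_mul, coeff_X_pow_mul_of_notMem (hsupp b)]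
    have hiff : (m N = parts (N + 1) lam (Fin.last N) +
        (∑ i : Fin N, (parts (N + 1) lam i.castSucc - b i) + C.card)) ↔
        (m N + ∑ i, b i = lam.card + C.card) := by omega
    simp only [hiff]
    split_ifs with h
    · have hb' := ih (lam := ofParts b) (m := m.erase N) (rowLen_ofParts_of_le hba le_rfl) (by
        intro k hk
        rw [Finsupp.erase_apply]
        split_ifs
        · rfl
        · exact hm k (by omega))
      rw [parts_ofParts hba] at hb'
      rw [hb', coeff_stableG, ← mul_assoc, card_ofParts hba]
      congr 1
      have hdeg : m.degree = m N + (m.erase N).degree := by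
        conv_lhs => rw [← Finsupp.erase_add_single N m]
        rw [map_add, Finsupp.degree_single, add_comm]
      rw [← zpow_natCast, ← zpow_add₀ (by norm_num)]
      congr 1
      omega
    · simp

theorem coeff_stableG_eq_zero {N : ℕ} {lam : YoungDiagram} (hN : lam.rowLen N ≠ 0) {m : ℕ →₀ ℕ}
    (hm : ∀ k, N ≤ k → m k = 0) : MvPowerSeries.coeff m (stableG lam) = 0 := by
  rw [coeff_stableG, tableauCount_eq_zero, Nat.cast_zero, mul_zero]
  intro T hT
  obtain ⟨a, ha⟩ := T.nonempty (YoungDiagram.mem_iff_lt_rowLen.mpr (Nat.pos_of_ne_zero hN))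
  have h1 := T.content_pos ha
  rw [hT, hm a (T.le_of_mem_entry ha)] at h1
  exact lt_irrefl _ h1

theorem exists_rowLen_eq_zero (mu : YoungDiagram) : ∃ N, ∀ i, N ≤ i → mu.rowLen i = 0 := by
  refine ⟨mu.colLen 0, fun i hi => ?_⟩
  by_contra! h
  have := YoungDiagram.mem_iff_lt_colLen.mp
    (YoungDiagram.mem_iff_lt_rowLen.mpr (Nat.pos_of_ne_zero h))
  omega

theorem exists_forall_le_eq_zero (m : ℕ →₀ ℕ) : ∃ N, ∀ k, N ≤ k → m k = 0 := by
  refine ⟨m.support.sup id + 1, fun k hk => ?_⟩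
  by_contra h
  have : k ≤ m.support.sup id := Finset.le_sup (f := id) (Finsupp.mem_support_iff.mpr h)
  omega

theorem isSymm_stableG (lam : YoungDiagram) : IsSymm (stableG lam) := by
  intro σ m
  obtain ⟨N₁, h1⟩ := exists_rowLen_eq_zero lam
  obtain ⟨N₂, h2⟩ := exists_forall_le_eq_zero m
  obtain ⟨N₃, h3⟩ := exists_forall_le_eq_zero (m.mapDomain σ)
  obtain ⟨N, hN1, hN2, hN3⟩ : ∃ N, N₁ ≤ N ∧ N₂ ≤ N ∧ N₃ ≤ N :=
    ⟨max N₁ (max N₂ N₃), by simp, by simp, by simp⟩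
  rw [← coeff_grothPoly (h1 N hN1) fun k hk => h2 k (hN2.trans hk),
    ← coeff_grothPoly (h1 N hN1) fun k hk => h3 k (hN3.trans hk)]
  obtain ⟨g, hg⟩ := Finset.exists_equiv_extend_of_card_eq (α := Fin N) (t := range N) (by simp)
    (s := univ.filter fun i : Fin N => m i ≠ 0) (f := fun i => σ i) (by
      intro j hj
      simp only [mem_image, mem_filter, mem_univ, true_and] at hj
      obtain ⟨i, hi, rfl⟩ := hj
      rw [mem_range]
      by_contra! hc
      apply hi
      rw [← h3 _ (hN3.trans hc), Finsupp.mapDomain_apply σ.injective])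
    (fun i _ j _ h => Fin.ext (σ.injective h))
  let τ : Equiv.Perm (Fin N) := g.trans
    ⟨fun x => ⟨x, mem_range.mp x.2⟩, fun i => ⟨i, mem_range.mpr i.2⟩, fun _ => rfl, fun _ => rfl⟩
  have hτ : ∀ i : Fin N, m i ≠ 0 → ((τ i : Fin N) : ℕ) = σ i := fun i hi => hg i (by simp [hi])
  let m' : Fin N →₀ ℕ := Finsupp.equivFunOnFinite.symm fun i => m i
  have hm' : m'.mapDomain Fin.val = m := by
    ext k
    by_cases hk : k < N
    · exact Finsupp.mapDomain_apply Fin.val_injective m' ⟨k, hk⟩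
    · rw [h2 k (by omega), Finsupp.mapDomain_of_notMem_range]
      rintro ⟨i, rfl⟩
      exact hk i.2
  have hσ : m.mapDomain σ = (m'.mapDomain τ).mapDomain Fin.val := by
    rw [← Finsupp.mapDomain_comp]
    nth_rewrite 1 [← hm']
    rw [← Finsupp.mapDomain_comp]
    refine Finsupp.mapDomain_congr fun i hi => ?_
    exact (hτ i (by simpa [m'] using hi)).symm
  rw [hσ, grothPoly_X_eq_rename, MvPolynomial.coeff_rename_mapDomain _ Fin.val_injective]
  conv_rhs => rw [← hm', MvPolynomial.coeff_rename_mapDomain _ Fin.val_injective,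
    ← MvPolynomial.coeff_rename_mapDomain τ τ.injective]
  congr 1
  have hmap := map_grothPoly (MvPolynomial.rename (R := ℂ) τ).toRingHom MvPolynomial.X
    (parts N lam)
  have hcomp : ((MvPolynomial.rename (R := ℂ) τ).toRingHom ∘ MvPolynomial.X :
      Fin N → MvPolynomial (Fin N) ℂ) = MvPolynomial.X ∘ τ := by
    ext i : 1; simp
  rw [hcomp, grothPoly_comp_perm _ (MvPolynomial.X_injective) _ (parts_antitone _ _)] at hmap
  exact hmap.symm

/-- The exponent `(mu_1, mu_2, …)`. -/
def rowExponent (mu : YoungDiagram) : ℕ →₀ ℕ := mu.rowLens.toFinsupp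

theorem rowExponent_apply (mu : YoungDiagram) (i : ℕ) : rowExponent mu i = mu.rowLen i := by
  rw [rowExponent, List.toFinsupp_apply]
  by_cases h : i < mu.rowLens.length
  · rw [List.getD_eq_getElem _ _ h, YoungDiagram.get_rowLens]
  · rw [List.getD_eq_default _ _ (not_lt.mp h)]
    rw [YoungDiagram.length_rowLens] at h
    by_contra! hc
    exact h (YoungDiagram.mem_iff_lt_colLen.mp
      (YoungDiagram.mem_iff_lt_rowLen.mpr (Nat.pos_of_ne_zero hc.symm)))

theorem exists_mapDomain_eq_rowExponent (m : ℕ →₀ ℕ) :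
    ∃ (σ : Equiv.Perm ℕ) (mu : YoungDiagram), m.mapDomain σ = rowExponent mu := by
  obtain ⟨N, hN⟩ := exists_forall_le_eq_zero m
  let f : Fin N → ℕᵒᵈ := fun i => OrderDual.toDual (m i)
  have hf : Antitone fun i : Fin N => m (Tuple.sort f i) := fun i j h => Tuple.monotone_sort f h
  let τ : Equiv.Perm ℕ := (Tuple.sort f).extendDomain Fin.equivSubtype
  refine ⟨τ.symm, ofParts fun i : Fin N => m (Tuple.sort f i), ?_⟩
  ext k
  rw [rowExponent_apply, Finsupp.mapDomain_equiv_apply, Equiv.symm_symm]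
  by_cases hk : k < N
  · have h1 : τ k = (Tuple.sort f ⟨k, hk⟩ : Fin N) :=
      Equiv.Perm.extendDomain_apply_image (Tuple.sort f) Fin.equivSubtype ⟨k, hk⟩
    rw [h1, rowLen_ofParts hf ⟨k, hk⟩]
  · have h1 : τ k = k := Equiv.Perm.extendDomain_apply_not_subtype _ _ hk
    rw [h1, rowLen_ofParts_of_le hf (not_lt.mp hk),
      hN k (not_lt.mp hk)]

/-- The number of boxes, weighted by row. -/
def rank (mu : YoungDiagram) : ℕ := ∑ c ∈ mu.cells, (c.1 + 1)

theorem card_le_rank (mu : YoungDiagram) : mu.card ≤ rank mu := by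
  rw [YoungDiagram.card, Finset.card_eq_sum_ones]
  exact Finset.sum_le_sum fun _ _ => Nat.le_add_left _ _

namespace SetValuedTableau

variable {mu : YoungDiagram}

theorem sum_entry (T : SetValuedTableau mu) {m : ℕ →₀ ℕ} (hT : ∀ k, T.content k = m k)
    (f : ℕ → ℕ) : ∑ c ∈ mu.cells, ∑ a ∈ T.entry c.1 c.2, f a = m.sum fun k n => n * f k := by
  have h1 : ∀ c ∈ mu.cells, ∑ a ∈ T.entry c.1 c.2, f a =
      ∑ a ∈ m.support, if a ∈ T.entry c.1 c.2 then f a else 0 := by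
    intro c _
    rw [← Finset.sum_filter]
    refine Finset.sum_congr ?_ fun _ _ => rfl
    ext a
    simp only [mem_filter, Finsupp.mem_support_iff, iff_and_self]
    intro ha
    rw [← hT]
    exact (T.content_pos ha).ne'
  rw [Finset.sum_congr rfl h1, Finset.sum_comm, Finsupp.sum]
  refine Finset.sum_congr rfl fun a _ => ?_
  rw [← Finset.sum_filter, Finset.sum_const, ← hT, content, smul_eq_mul]

theorem card_le_degree (T : SetValuedTableau mu) {m : ℕ →₀ ℕ} (hT : ∀ k, T.content k = m k) :
    mu.card ≤ m.degree := by
  have h := T.sum_entry hT fun _ => 1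
  simp only [mul_one] at h
  rw [Finsupp.degree_apply]
  refine le_trans ?_ h.le
  rw [YoungDiagram.card, Finset.card_eq_sum_ones]
  refine Finset.sum_le_sum fun c hc => ?_
  rw [Finset.sum_const, smul_eq_mul, mul_one]
  exact Finset.card_pos.mpr (T.nonempty (YoungDiagram.mem_cells c |>.mp hc))

/-- The tableau with every box of row `i` filled with `i`. -/
def superstandard (mu : YoungDiagram) : SetValuedTableau mu where
  entry i j := if (i, j) ∈ mu then {i} else ∅
  nonempty {i j} h := by simp [h]
  row_weak {i j₁ j₂} hj h a ha b hb := by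
    rw [if_pos h] at hb
    rw [if_pos (mu.up_left_mem le_rfl hj.le h)] at ha
    simp_all
  col_strict {i₁ i₂ j} hi h a ha b hb := by
    rw [if_pos h] at hb
    rw [if_pos (mu.up_left_mem hi.le le_rfl h)] at ha
    simp_all
  empty_off h := by simp [h]

theorem content_superstandard (mu : YoungDiagram) (k : ℕ) :
    (superstandard mu).content k = mu.rowLen k := by
  rw [content, YoungDiagram.rowLen_eq_card]
  congr 1
  ext ⟨i, j⟩
  simp only [mem_filter, YoungDiagram.mem_cells, YoungDiagram.mem_row_iff]
  refine and_congr_right fun h => ?_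
  simp only [superstandard]
  rw [if_pos h, Finset.mem_singleton, eq_comm]

theorem sum_rowExponent (mu : YoungDiagram) :
    ((rowExponent mu).sum fun k n => n * (k + 1)) = rank mu := by
  rw [← (superstandard mu).sum_entry
    (fun k => (content_superstandard mu k).trans (rowExponent_apply mu k).symm) fun a => a + 1, rank]
  refine Finset.sum_congr rfl fun c hc => ?_
  have hc : (c.1, c.2) ∈ mu := hc
  simp [superstandard, hc]

theorem rank_le_and_eq_superstandard (T : SetValuedTableau mu) {nu : YoungDiagram}
    (hT : ∀ k, T.content k = rowExponent nu k) :
    rank mu ≤ rank nu ∧ (rank nu ≤ rank mu → T = superstandard mu) := by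
  have h := (T.sum_entry hT fun a => a + 1).trans (sum_rowExponent nu)
  have hle : ∀ c ∈ mu.cells, c.1 + 1 ≤ ∑ a ∈ T.entry c.1 c.2, (a + 1) := by
    rintro ⟨i, j⟩ hc
    obtain ⟨a, ha⟩ := T.nonempty ((YoungDiagram.mem_cells _).mp hc)
    exact (Nat.succ_le_succ (T.le_of_mem_entry ha)).trans
      (Finset.single_le_sum (f := fun a => a + 1) (fun _ _ => Nat.zero_le _) ha)
  refine ⟨h ▸ Finset.sum_le_sum hle, fun h' => ext_entry fun i j => ?_⟩
  have heq := (Finset.sum_eq_sum_iff_of_le hle).mp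
    (le_antisymm (Finset.sum_le_sum hle) (h ▸ h'))
  by_cases hm : (i, j) ∈ mu
  · have hij := heq (i, j) hm
    simp only [superstandard, if_pos hm]
    obtain ⟨a, ha⟩ := T.nonempty hm
    have hall : ∀ b ∈ T.entry i j, b = i := by
      intro b hb
      have h1 := Finset.single_le_sum (f := fun a => a + 1) (fun _ _ => Nat.zero_le _) hb
      have h2 := T.le_of_mem_entry hb
      simp only at hij h1
      omega
    refine Finset.eq_singleton_iff_unique_mem.mpr ⟨?_, hall⟩
    exact hall a ha ▸ ha
  · rw [T.empty_off hm, (superstandard mu).empty_off hm]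

theorem content_le_rowLen (T : SetValuedTableau mu) (k : ℕ) : T.content k ≤ mu.rowLen 0 := by
  rw [← Finset.card_range (mu.rowLen 0), content]
  refine Finset.card_le_card_of_injOn Prod.snd ?_ ?_
  · rintro ⟨i, j⟩ h
    simp only [coe_filter, Set.mem_ofPred_eq, YoungDiagram.mem_cells] at h
    simp only [coe_range, Set.mem_Iio]
    exact YoungDiagram.mem_iff_lt_rowLen.mp (mu.up_left_mem (Nat.zero_le i) le_rfl h.1)
  · rintro ⟨i, j⟩ h ⟨i', j'⟩ h' (rfl : j = j')
    simp only [coe_filter, Set.mem_ofPred_eq, YoungDiagram.mem_cells] at h h'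
    rcases lt_trichotomy i i' with hi | rfl | hi
    · exact absurd (T.col_strict hi h'.1 k h.2 k h'.2) (lt_irrefl k)
    · rfl
    · exact absurd (T.col_strict hi h.1 k h'.2 k h.2) (lt_irrefl k)

end SetValuedTableau

theorem coeff_stableG_ne_zero {mu : YoungDiagram} {m : ℕ →₀ ℕ}
    (h : MvPowerSeries.coeff m (stableG mu) ≠ 0) :
    ∃ T : SetValuedTableau mu, ∀ k, T.content k = m k := by
  by_contra! hc
  apply h
  rw [coeff_stableG, tableauCount_eq_zero fun T hT => (hc T).elim fun k hk => hk (hT k),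
    Nat.cast_zero, mul_zero]

theorem degree_rowExponent (mu : YoungDiagram) : (rowExponent mu).degree = mu.card := by
  have := (SetValuedTableau.superstandard mu).sum_entry (fun k =>
    (SetValuedTableau.content_superstandard mu k).trans (rowExponent_apply mu k).symm) fun _ => 1
  simp only [mul_one] at this
  rw [Finsupp.degree_apply]
  refine this.symm.trans ?_
  rw [YoungDiagram.card, Finset.card_eq_sum_ones]
  refine Finset.sum_congr rfl fun c hc => ?_
  have hc : (c.1, c.2) ∈ mu := hc
  simp [SetValuedTableau.superstandard, hc]

theorem coeff_stableG_rowExponent_self (mu : YoungDiagram) :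
    MvPowerSeries.coeff (rowExponent mu) (stableG mu) = 1 := by
  have h1 : tableauCount mu (rowExponent mu) = 1 := by
    rw [tableauCount, Nat.card_eq_one_iff_unique]
    refine ⟨⟨fun T T' => Subtype.ext ?_⟩, ⟨⟨SetValuedTableau.superstandard mu, fun k => ?_⟩⟩⟩
    · rw [(T.1.rank_le_and_eq_superstandard T.2).2 le_rfl,
        (T'.1.rank_le_and_eq_superstandard T'.2).2 le_rfl]
    · rw [SetValuedTableau.content_superstandard, rowExponent_apply]
  rw [coeff_stableG, h1, degree_rowExponent]
  simp

theorem eq_or_rank_lt_of_coeff_ne_zero {mu nu : YoungDiagram}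
    (h : MvPowerSeries.coeff (rowExponent nu) (stableG mu) ≠ 0) : mu = nu ∨ rank mu < rank nu := by
  obtain ⟨T, hT⟩ := coeff_stableG_ne_zero h
  obtain ⟨h1, h2⟩ := T.rank_le_and_eq_superstandard hT
  rcases h1.lt_or_eq with h1 | h1
  · exact Or.inr h1
  · left
    refine ext_rowLen fun i => ?_
    rw [← SetValuedTableau.content_superstandard, ← h2 h1.ge, hT, rowExponent_apply]

theorem finite_le (mu : YoungDiagram) : {nu | nu ≤ mu}.Finite := by
  refine Set.Finite.of_finite_image (f := YoungDiagram.cells) ?_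
    (fun _ _ _ _ h => YoungDiagram.ext h)
  refine (mu.cells.powerset.finite_toSet).subset ?_
  rintro _ ⟨nu, h, rfl⟩
  exact Finset.mem_coe.mpr (Finset.mem_powerset.mpr (YoungDiagram.cells_subset_iff.mpr h))

theorem le_rect {mu : YoungDiagram} {a b : ℕ} (h1 : mu.rowLen a = 0) (h2 : mu.rowLen 0 ≤ b) :
    mu ≤ rect a b := by
  rintro ⟨i, j⟩ h
  have hj := YoungDiagram.mem_iff_lt_rowLen.mp h
  have h0 := mu.rowLen_anti 0 i (Nat.zero_le i)
  refine (YoungDiagram.mem_cells _).mp ?_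
  simp only [rect, mem_product, mem_range]
  refine ⟨?_, by omega⟩
  by_contra! hc
  have := mu.rowLen_anti _ _ hc
  omega

theorem finite_card_le (k : ℕ) : {mu : YoungDiagram | mu.card ≤ k}.Finite := by
  refine (finite_le (rect k k)).subset fun mu (hmu : mu.card ≤ k) => ?_
  refine le_rect ?_ ?_
  · by_contra! hc
    have h1 := YoungDiagram.mem_iff_lt_colLen.mp
      (YoungDiagram.mem_iff_lt_rowLen.mpr (Nat.pos_of_ne_zero hc))
    rw [YoungDiagram.colLen_eq_card] at h1
    have h2 : (mu.col 0).card ≤ mu.card := Finset.card_le_card (Finset.filter_subset _ _)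
    omega
  · rw [YoungDiagram.rowLen_eq_card]
    exact (Finset.card_le_card (Finset.filter_subset _ _)).trans hmu

/-- The Young diagram with `α i` rows of length `i + 1`. -/
noncomputable def shapeOf (α : ℕ →₀ ℕ) : YoungDiagram :=
  YoungDiagram.ofRowLens (((Finsupp.toMultiset α).map (· + 1)).sort (· ≥ ·))
    (Multiset.pairwise_sort _ _).sortedGE

/-- The exponent `α` such that `mu` has `α i` rows of length `i + 1`. -/
noncomputable def multiplicities (mu : YoungDiagram) : ℕ →₀ ℕ :=
  Multiset.toFinsupp ((mu.rowLens : Multiset ℕ).map (· - 1))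

theorem rowLens_shapeOf (α : ℕ →₀ ℕ) :
    (shapeOf α).rowLens = ((Finsupp.toMultiset α).map (· + 1)).sort (· ≥ ·) := by
  refine YoungDiagram.rowLens_ofRowLens_eq_self fun x hx => ?_
  rw [Multiset.mem_sort, Multiset.mem_map] at hx
  obtain ⟨y, -, rfl⟩ := hx
  exact Nat.succ_pos y

theorem rowExponent_shapeOf (α : ℕ →₀ ℕ) : rowExponent (shapeOf α) = partsExponent α := by
  rw [rowExponent, partsExponent, rowLens_shapeOf]

theorem multiplicities_shapeOf (α : ℕ →₀ ℕ) : multiplicities (shapeOf α) = α := by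
  rw [multiplicities, rowLens_shapeOf, Multiset.sort_eq, Multiset.map_map]
  simp

theorem partsExponent_multiplicities (mu : YoungDiagram) :
    partsExponent (multiplicities mu) = rowExponent mu := by
  have h1 : ((Finsupp.toMultiset (multiplicities mu)).map (· + 1)) = (mu.rowLens : Multiset ℕ) := by
    rw [multiplicities, Multiset.toFinsupp_toMultiset, Multiset.map_map]
    conv_rhs => rw [← Multiset.map_id (mu.rowLens : Multiset ℕ)]
    refine Multiset.map_congr rfl fun x hx => ?_
    exact Nat.sub_add_cancel (mu.pos_of_mem_rowLens x hx)
  rw [partsExponent, rowExponent, h1]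
  congr 1
  refine List.Perm.eq_of_pairwise' (Multiset.pairwise_sort _ _) mu.rowLens_sorted.pairwise ?_
  rw [← Multiset.coe_eq_coe, Multiset.sort_eq]

theorem hall_eq_sum {p : SymFun} {S : Finset (ℕ →₀ ℕ)} (h : p.support ⊆ S)
    (f : MvPowerSeries ℕ ℂ) :
    hall p f = ∑ α ∈ S, p.coeff α * MvPowerSeries.coeff (partsExponent α) f :=
  Finset.sum_subset h fun α _ hα => by rw [MvPolynomial.notMem_support_iff.mp hα, zero_mul]

/-- The Hall pairing as a linear map in its first argument. -/
noncomputable def hallLeft (f : MvPowerSeries ℕ ℂ) : SymFun →ₗ[ℂ] ℂ where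
  toFun p := hall p f
  map_add' p q := by
    classical
    rw [hall_eq_sum (MvPolynomial.support_add (p := p) (q := q)),
      hall_eq_sum (p := p) Finset.subset_union_left, hall_eq_sum (p := q) Finset.subset_union_right,
      ← Finset.sum_add_distrib]
    simp only [MvPolynomial.coeff_add, add_mul]
  map_smul' c p := by
    rw [hall_eq_sum (MvPolynomial.support_smul (a := c) (f := p)), hall, Finset.smul_sum]
    simp only [MvPolynomial.coeff_smul, smul_eq_mul, mul_assoc, RingHom.id_apply]

theorem hallLeft_apply (p : SymFun) (f : MvPowerSeries ℕ ℂ) : hallLeft f p = hall p f := rfl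

/-- The Hall pairing as a linear map in its second argument. -/
noncomputable def hallRight (p : SymFun) : MvPowerSeries ℕ ℂ →ₗ[ℂ] ℂ where
  toFun f := hall p f
  map_add' f g := by
    simp only [hall, map_add, mul_add, Finset.sum_add_distrib]
  map_smul' c f := by
    simp only [hall, map_smul, smul_eq_mul, Finset.mul_sum, RingHom.id_apply]
    exact Finset.sum_congr rfl fun _ _ => mul_left_comm _ _ _

theorem hallRight_apply (p : SymFun) (f : MvPowerSeries ℕ ℂ) : hallRight p f = hall p f := rfl

theorem hall_monomial (α : ℕ →₀ ℕ) (c : ℂ) (f : MvPowerSeries ℕ ℂ) :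
    hall (MvPolynomial.monomial α c) f = c * MvPowerSeries.coeff (partsExponent α) f := by
  rw [hall_eq_sum MvPolynomial.support_monomial_subset, Finset.sum_singleton,
    MvPolynomial.coeff_monomial, if_pos rfl]

/-- The stable Grothendieck polynomials separate symmetric functions. -/
theorem eq_zero_of_hall_stableG {p : SymFun} (h : ∀ mu, hall p (stableG mu) = 0) : p = 0 := by
  by_contra hp
  obtain ⟨α, hα, hmax⟩ := Finset.exists_max_image p.support (fun α => rank (shapeOf α))
    (MvPolynomial.support_nonempty.mpr hp)
  have h1 := h (shapeOf α)
  rw [hall, Finset.sum_eq_single_of_mem α hα, ← rowExponent_shapeOf,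
    coeff_stableG_rowExponent_self, mul_one] at h1
  · exact MvPolynomial.mem_support_iff.mp hα h1
  · intro β hβ hne
    by_contra hc
    rw [← rowExponent_shapeOf] at hc
    rcases eq_or_rank_lt_of_coeff_ne_zero (right_ne_zero_of_mul hc) with h2 | h2
    · apply hne
      rw [← multiplicities_shapeOf α, h2, multiplicities_shapeOf]
    · exact absurd (hmax β hβ) (not_le.mpr h2)

theorem eq_of_hall_stableG {p q : SymFun} (h : ∀ mu, hall p (stableG mu) = hall q (stableG mu)) :
    p = q := by
  refine sub_eq_zero.mp (eq_zero_of_hall_stableG fun mu => ?_)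
  rw [← hallLeft_apply, map_sub, hallLeft_apply, hallLeft_apply, h, sub_self]

/-- Power series with integer coefficients. -/
def HasIntCoeffs (f : MvPowerSeries ℕ ℂ) : Prop :=
  ∀ m, MvPowerSeries.coeff m f ∈ (Int.castRingHom ℂ).range

theorem HasIntCoeffs.mul {f g : MvPowerSeries ℕ ℂ} (hf : HasIntCoeffs f) (hg : HasIntCoeffs g) :
    HasIntCoeffs (f * g) := fun m => by
  rw [MvPowerSeries.coeff_mul]
  exact sum_mem fun p _ => mul_mem (hf _) (hg _)

theorem hasIntCoeffs_stableG (mu : YoungDiagram) : HasIntCoeffs (stableG mu) := fun m => by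
  rw [coeff_stableG]
  refine mul_mem ?_ ⟨(tableauCount mu m : ℤ), by simp⟩
  rcases Int.even_or_odd ((m.degree : ℤ) - mu.card) with h | h
  · rw [h.neg_one_zpow]
    exact one_mem _
  · rw [h.neg_one_zpow]
    exact neg_mem (one_mem _)

open Classical in
theorem exists_dual (nu : YoungDiagram) : ∃ p : SymFun,
    (∀ mu, hall p (stableG mu) = if nu = mu then 1 else 0) ∧
      ∀ f, HasIntCoeffs f → hall p f ∈ (Int.castRingHom ℂ).range := by
  induction h : rank nu using Nat.strong_induction_on generalizing nu with
  | _ r ih =>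
  subst h
  have ih : ∀ kappa, rank kappa < rank nu → ∃ p : SymFun,
    (∀ mu, hall p (stableG mu) = if kappa = mu then 1 else 0) ∧
      ∀ f, HasIntCoeffs f → hall p f ∈ (Int.castRingHom ℂ).range := fun kappa hk =>
    ih _ hk kappa rfl
  choose! g hg1 hg2 using ih
  have hfin : {kappa | rank kappa < rank nu}.Finite :=
    (finite_card_le (rank nu)).subset fun kappa (hk : rank kappa < rank nu) =>
      (card_le_rank kappa).trans hk.le
  have key : ∀ f, hall (MvPolynomial.monomial (multiplicities nu) 1 -
      ∑ kappa ∈ hfin.toFinset,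
        MvPowerSeries.coeff (rowExponent nu) (stableG kappa) • g kappa) f =
      MvPowerSeries.coeff (rowExponent nu) f - ∑ kappa ∈ hfin.toFinset,
        MvPowerSeries.coeff (rowExponent nu) (stableG kappa) * hall (g kappa) f := by
    intro f
    rw [← hallLeft_apply, map_sub, map_sum, hallLeft_apply, hall_monomial, one_mul,
      partsExponent_multiplicities]
    simp only [map_smul, smul_eq_mul, hallLeft_apply]
  refine ⟨_, fun mu => (key _).trans ?_, fun f hf => (key f).symm ▸ ?_⟩
  · have hsum : ∑ kappa ∈ hfin.toFinset,
        MvPowerSeries.coeff (rowExponent nu) (stableG kappa) * hall (g kappa) (stableG mu) =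
        if rank mu < rank nu then MvPowerSeries.coeff (rowExponent nu) (stableG mu) else 0 := by
      have : ∀ kappa ∈ hfin.toFinset,
          MvPowerSeries.coeff (rowExponent nu) (stableG kappa) * hall (g kappa) (stableG mu) =
          if kappa = mu then MvPowerSeries.coeff (rowExponent nu) (stableG mu) else 0 := by
        intro kappa hk
        rw [hg1 kappa (by simpa using hk)]
        split_ifs with h
        · rw [h, mul_one]
        · rw [mul_zero]
      rw [Finset.sum_congr rfl this, Finset.sum_ite_eq']
      simp
    rw [hsum]
    split_ifs with h1 h2 h2
    · subst h2; exact absurd h1 (lt_irrefl _)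
    · exact sub_self _
    · subst h2; rw [coeff_stableG_rowExponent_self, sub_zero]
    · by_contra hc
      rw [sub_zero] at hc
      rcases eq_or_rank_lt_of_coeff_ne_zero hc with h | h
      · exact h2 h.symm
      · exact h1 h
  · exact sub_mem (hf _) (sum_mem fun kappa hk => mul_mem (hasIntCoeffs_stableG _ _)
      (hg2 kappa (by simpa using hk) f hf))

theorem existsUnique_isDualFamily : ∃! g : YoungDiagram → SymFun, IsDualFamily g := by
  classical
  choose g hg using exists_dual
  refine ⟨g, fun lam mu => ?_, fun g' hg' => funext fun lam => eq_of_hall_stableG fun mu => ?_⟩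
  · convert (hg lam).1 mu
  · rw [hg' lam mu]
    convert ((hg lam).1 mu).symm

theorem IsDualFamily.hall_mem_range {g : YoungDiagram → SymFun} (hg : IsDualFamily g)
    (nu : YoungDiagram) {f : MvPowerSeries ℕ ℂ} (hf : HasIntCoeffs f) :
    hall (g nu) f ∈ (Int.castRingHom ℂ).range := by
  classical
  obtain ⟨p, hp, hp'⟩ := exists_dual nu
  have : g nu = p := eq_of_hall_stableG fun mu => by
    rw [hg, hp]
  rw [this]
  exact hp' f hf

/-- The expansion of a symmetric power series in stable Grothendieck polynomials. -/
theorem IsDualFamily.coeff_eq_sum {g : YoungDiagram → SymFun} (hg : IsDualFamily g)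
    {f : MvPowerSeries ℕ ℂ} (hf : IsSymm f) (m : ℕ →₀ ℕ) {S : Finset YoungDiagram}
    (hS : ∀ mu : YoungDiagram, mu.card ≤ m.degree → mu ∈ S) :
    MvPowerSeries.coeff m f =
      ∑ mu ∈ S, hall (g mu) f * MvPowerSeries.coeff m (stableG mu) := by
  classical
  obtain ⟨σ, nu, hσ⟩ := exists_mapDomain_eq_rowExponent m
  have hdeg : m.degree = (rowExponent nu).degree := by rw [← hσ, Finsupp.degree_mapDomain]
  rw [← hf σ m, hσ]
  have h1 : MvPolynomial.monomial (multiplicities nu) 1 =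
      ∑ mu ∈ S, MvPowerSeries.coeff (rowExponent nu) (stableG mu) • g mu := by
    refine eq_of_hall_stableG fun kappa => ?_
    rw [hall_monomial, one_mul, partsExponent_multiplicities, ← hallLeft_apply, map_sum]
    simp only [map_smul, smul_eq_mul, hallLeft_apply, hg _ kappa, mul_ite, mul_one, mul_zero]
    rw [Finset.sum_ite_eq']
    split_ifs with h
    · rfl
    · by_contra hc
      obtain ⟨T, hT⟩ := coeff_stableG_ne_zero hc
      exact h (hS _ ((T.card_le_degree hT).trans hdeg.ge))
  have h2 := congrArg (hallLeft f) h1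
  rw [hallLeft_apply, hall_monomial, one_mul, partsExponent_multiplicities, map_sum] at h2
  rw [h2]
  refine Finset.sum_congr rfl fun mu _ => ?_
  rw [map_smul, smul_eq_mul, hallLeft_apply, mul_comm, ← hσ, isSymm_stableG mu σ m]

theorem IsSymm.mul {f g : MvPowerSeries ℕ ℂ} (hf : IsSymm f) (hg : IsSymm g) : IsSymm (f * g) := by
  classical
  intro σ m
  rw [MvPowerSeries.coeff_mul, MvPowerSeries.coeff_mul]
  have h1 : ∀ x : ℕ →₀ ℕ, (x.mapDomain σ).mapDomain σ.symm = x := fun x => by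
    rw [← Finsupp.mapDomain_comp, Equiv.symm_comp_self, Finsupp.mapDomain_id]
  have h2 : ∀ x : ℕ →₀ ℕ, (x.mapDomain σ.symm).mapDomain σ = x := fun x => by
    rw [← Finsupp.mapDomain_comp, Equiv.self_comp_symm, Finsupp.mapDomain_id]
  refine Finset.sum_nbij' (fun p => (p.1.mapDomain σ.symm, p.2.mapDomain σ.symm))
    (fun p => (p.1.mapDomain σ, p.2.mapDomain σ)) ?_ ?_ ?_ ?_ ?_
  · intro p hp
    rw [HasAntidiagonal.mem_antidiagonal] at hp ⊢
    rw [← Finsupp.mapDomain_add, hp, h1]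
  · intro p hp
    rw [HasAntidiagonal.mem_antidiagonal] at hp ⊢
    rw [← Finsupp.mapDomain_add, hp]
  · intro p _
    simp only [h2]
  · intro p _
    simp only [h1]
  · intro p _
    rw [← hf σ (p.1.mapDomain σ.symm), ← hg σ (p.2.mapDomain σ.symm), h2, h2]

theorem existsUnique_isPerp (f : MvPowerSeries ℕ ℂ) : ∃! D : SymFun →ₗ[ℂ] SymFun, IsPerp f D := by
  classical
  choose σ mu hmu using exists_mapDomain_eq_rowExponent
  let D : SymFun →ₗ[ℂ] SymFun := (MvPolynomial.basisMonomials ℕ ℂ).constr ℂ fun β =>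
    ∑ p ∈ antidiagonal (partsExponent β), MvPowerSeries.coeff p.1 f •
      MvPolynomial.monomial (multiplicities (mu p.2)) 1
  have hD : IsPerp f D := by
    intro p u hu
    have h : (hallLeft u).comp D = hallLeft (f * u) := by
      refine (MvPolynomial.basisMonomials ℕ ℂ).ext fun β => ?_
      rw [LinearMap.comp_apply, Module.Basis.constr_basis, map_sum, MvPolynomial.coe_basisMonomials,
        hallLeft_apply, hall_monomial, one_mul, MvPowerSeries.coeff_mul]
      refine Finset.sum_congr rfl fun p _ => ?_
      rw [map_smul, smul_eq_mul, hallLeft_apply, hall_monomial, one_mul,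
        partsExponent_multiplicities, ← hmu, hu]
    exact LinearMap.congr_fun h p
  refine ⟨D, hD, fun D' hD' => LinearMap.ext fun p => eq_of_hall_stableG fun nu => ?_⟩
  rw [hD' p _ (isSymm_stableG nu), hD p _ (isSymm_stableG nu)]

section RowBound

variable {R : Type*} [CommRing R] {d : ℕ}

/-- The alternating sum of values at the nodes `y`, weighted by the alternants in the remaining
nodes. -/
def altSum (y : Fin (d + 1) → R) (a : Fin d → ℕ) : (Fin (d + 1) → R) →ₗ[R] R :=
  ∑ i : Fin (d + 1), ((-1) ^ (i : ℕ) * altDet (y ∘ i.succAbove) a) • LinearMap.proj i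

theorem altSum_apply (y : Fin (d + 1) → R) (a : Fin d → ℕ) (v : Fin (d + 1) → R) :
    altSum y a v = ∑ i : Fin (d + 1), (-1) ^ (i : ℕ) * altDet (y ∘ i.succAbove) a * v i := by
  simp [altSum]

theorem altSum_row (y : Fin (d + 1) → R) (a : Fin d → ℕ) (j : Fin d) :
    altSum y a (fun i => y i ^ (a j + (d - 1 - j)) * (1 - y i) ^ (j : ℕ)) = 0 := by
  have h : (Matrix.of (Fin.cons (fun i => y i ^ (a j + (d - 1 - j)) * (1 - y i) ^ (j : ℕ))
      fun (j : Fin d) i => y i ^ (a j + (d - 1 - j)) * (1 - y i) ^ (j : ℕ)) :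
      Matrix (Fin (d + 1)) (Fin (d + 1)) R).det = 0 :=
    Matrix.det_zero_of_row_eq (Fin.succ_ne_zero j) (by ext i; simp)
  rw [Matrix.det_succ_row_zero] at h
  rw [altSum_apply, ← h]
  refine Finset.sum_congr rfl fun i _ => ?_
  simp only [Matrix.of_apply, Fin.cons_zero, mul_right_comm]
  rfl

theorem altSum_of_rows_le (y : Fin (d + 1) → R) (a : Fin d → ℕ) {p k : ℕ}
    (ha : ∀ j : Fin d, p ≤ j → a j = 0) (hk : k + p < d) :
    altSum y a (fun i => y i ^ k * (1 - y i) ^ p) = 0 := by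
  obtain ⟨q, rfl⟩ : ∃ q, d = k + p + q + 1 := ⟨d - 1 - k - p, by omega⟩
  have h : (fun i => y i ^ k * (1 - y i) ^ p) = ∑ s ∈ range (q + 1), (q.choose s : R) •
      fun i => y i ^ (k + s) * (1 - y i) ^ (p + (q - s)) := by
    ext i
    have := add_pow (y i) (1 - y i) q
    rw [add_sub_cancel, one_pow] at this
    rw [Finset.sum_apply]
    refine (mul_one _).symm.trans ((congrArg _ this).trans ?_)
    rw [Finset.mul_sum]
    refine Finset.sum_congr rfl fun s _ => ?_
    simp only [Pi.smul_apply, smul_eq_mul]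
    ring
  rw [h, map_sum]
  refine Finset.sum_eq_zero fun s hs => ?_
  rw [mem_range] at hs
  have hj : p + (q - s) < k + p + q + 1 := by omega
  have := altSum_row y a ⟨p + (q - s), hj⟩
  rw [ha _ (by simp)] at this
  have he : 0 + (k + p + q + 1 - 1 - (p + (q - s))) = k + s := by omega
  simp only [he] at this
  rw [map_smul, this, smul_zero]

theorem altSum_eval_of_degree_lt (y : Fin (d + 1) → R) {q : Polynomial R}
    (hq : q.degree < d) : altSum y 0 (fun i => q.eval (y i)) = 0 := by
  by_cases hq0 : q = 0
  · simp only [hq0, Polynomial.eval_zero]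
    exact map_zero (altSum y 0)
  have h : (fun i => q.eval (y i)) = ∑ k ∈ range d, q.coeff k • fun i => y i ^ k := by
    ext i
    rw [Polynomial.eval_eq_sum_range' ((Polynomial.natDegree_lt_iff_degree_lt hq0).mpr hq), Finset.sum_apply]
    simp
  rw [h, map_sum]
  refine Finset.sum_eq_zero fun k hk => ?_
  have := altSum_of_rows_le y 0 (p := 0) (k := k) (fun _ _ => rfl) (mem_range.mp hk)
  simp only [pow_zero, mul_one] at this
  rw [map_smul, this, smul_zero]

theorem grothPoly_zero_eq_one {N : ℕ} (x : Fin N → R) : grothPoly N x 0 = 1 := by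
  induction N with
  | zero => rfl
  | succ N ih =>
    have : (Fintype.piFinset fun i : Fin N => Icc ((0 : Fin (N + 1) → ℕ) i.succ)
        ((0 : Fin (N + 1) → ℕ) i.castSucc)) = {0} := by
      ext b
      simp [funext_iff]
    rw [grothPoly, this]
    simp [branchWeight, ih]

end RowBound

section Field

variable {K : Type*} [Field K] {d : ℕ} {y : Fin (d + 1) → K}

theorem altSum_pow_ne_zero (hy : Function.Injective y) : altSum y 0 (fun i => y i ^ d) ≠ 0 := by
  intro h0
  have h1 : ∀ q : Polynomial K, q.degree < (d + 1 : ℕ) →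
      altSum y 0 (fun i => q.eval (y i)) = 0 := by
    intro q hq
    have h : (fun i => q.eval (y i)) = (fun i => (q - Polynomial.monomial d (q.coeff d)).eval (y i))
        + q.coeff d • fun i => y i ^ d := by
      ext i; simp
    rw [h, map_add, map_smul, h0, smul_zero, add_zero]
    refine altSum_eval_of_degree_lt y ((Polynomial.degree_lt_iff_coeff_zero _ _).mpr fun n hn => ?_)
    rw [Polynomial.coeff_sub, Polynomial.coeff_monomial]
    split_ifs with hdn
    · rw [hdn, sub_self]
    · rw [(Polynomial.degree_lt_iff_coeff_zero _ _).mp hq n (by omega), sub_zero]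
  have h2 := h1 (Lagrange.interpolate univ y (Pi.single 0 1)) (by
    have := Lagrange.degree_interpolate_lt (s := univ) (v := y) (Pi.single 0 1) hy.injOn
    rwa [Finset.card_univ, Fintype.card_fin] at this)
  have h3 : (fun i => (Lagrange.interpolate univ y (Pi.single 0 1)).eval (y i)) =
      Pi.single 0 1 := by
    ext i
    exact Lagrange.eval_interpolate_at_node _ hy.injOn (mem_univ i)
  rw [h3, altSum_apply, Finset.sum_eq_single 0] at h2
  · simp at h2
    exact altDet_zero_ne_zero _ (hy.comp (Fin.succ_injective d)) h2
  · intro i _ hi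
    simp [hi]
  · simp

/-- Removing the variable `t` from a stable Grothendieck polynomial with at most `p` rows gives,
after multiplication by `(1 - t) ^ p`, a polynomial of degree at most `p` in `t`. -/
theorem exists_polynomial_grothPoly (hy : Function.Injective y) {a : Fin d → ℕ} (ha : Antitone a)
    {p : ℕ} (hp : ∀ j : Fin d, p ≤ j → a j = 0) :
    ∃ r : Polynomial K, r.natDegree ≤ p ∧
      ∀ i, r.eval (y i) = grothPoly d (y ∘ i.succAbove) a * (1 - y i) ^ p := by
  set r := Lagrange.interpolate univ y fun i => grothPoly d (y ∘ i.succAbove) a * (1 - y i) ^ p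
    with hr
  have heval : ∀ i, r.eval (y i) = grothPoly d (y ∘ i.succAbove) a * (1 - y i) ^ p := fun i =>
    Lagrange.eval_interpolate_at_node _ hy.injOn (mem_univ i)
  refine ⟨r, ?_, heval⟩
  have hdeg : r.natDegree ≤ d := by
    have h := Lagrange.degree_interpolate_lt (s := univ) (v := y)
      (fun i => grothPoly d (y ∘ i.succAbove) a * (1 - y i) ^ p) hy.injOn
    rw [Finset.card_univ, Fintype.card_fin] at h
    exact Polynomial.natDegree_le_iff_coeff_eq_zero.mpr fun n hn =>
      (Polynomial.degree_lt_iff_coeff_zero _ _).mp h n hn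
  by_contra! hc
  obtain ⟨k, hk⟩ := Nat.exists_eq_add_of_le hdeg
  have h1 : altSum y 0 (fun i => (Polynomial.X ^ k * r).eval (y i)) = 0 := by
    rw [← altSum_of_rows_le y a (k := k) hp (by omega), altSum_apply, altSum_apply]
    refine Finset.sum_congr rfl fun i _ => ?_
    rw [← altDet_zero_mul_grothPoly _ a ha, Polynomial.eval_mul, heval]
    simp only [Polynomial.eval_pow, Polynomial.eval_X]
    ring
  have hlc : r.leadingCoeff ≠ 0 := by
    rw [Polynomial.leadingCoeff_ne_zero]
    rintro h
    rw [h] at hc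
    simp at hc
  have h2 : (fun i => (Polynomial.X ^ k * r).eval (y i)) =
      (fun i => (Polynomial.X ^ k * r.eraseLead).eval (y i)) +
        r.leadingCoeff • fun i => y i ^ d := by
    ext i
    conv_lhs => rw [← Polynomial.eraseLead_add_monomial_natDegree_leadingCoeff r]
    simp only [Polynomial.eval_mul, Polynomial.eval_add, Polynomial.eval_pow, Polynomial.eval_X,
      Polynomial.eval_monomial, Pi.add_apply, Pi.smul_apply, smul_eq_mul, hk]
    ring
  rw [h2, map_add, map_smul, altSum_eval_of_degree_lt, zero_add, smul_eq_mul] at h1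
  · exact (mul_ne_zero hlc (altSum_pow_ne_zero hy)) h1
  · refine (Polynomial.degree_lt_iff_coeff_zero _ _).mpr fun n hn => ?_
    rw [Polynomial.coeff_X_pow_mul', if_pos (by omega), Polynomial.eraseLead_coeff]
    split_ifs with h
    · rfl
    · exact Polynomial.coeff_eq_zero_of_natDegree_lt (by omega)

theorem altSum_grothPoly_mul_grothPoly (hy : Function.Injective y) {a b : Fin d → ℕ}
    (ha : Antitone a) (hb : Antitone b) {p q : ℕ} (hp : ∀ j : Fin d, p ≤ j → a j = 0)
    (hq : ∀ j : Fin d, q ≤ j → b j = 0) (hpq : p + q < d) :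
    altSum y 0 (fun i => (1 - y i) ^ (d - 1) *
      (grothPoly d (y ∘ i.succAbove) a * grothPoly d (y ∘ i.succAbove) b)) = 0 := by
  obtain ⟨r, hr, hr'⟩ := exists_polynomial_grothPoly hy ha hp
  obtain ⟨s, hs, hs'⟩ := exists_polynomial_grothPoly hy hb hq
  obtain ⟨e, rfl⟩ : ∃ e, d = p + q + e + 1 := ⟨d - 1 - p - q, by omega⟩
  rw [← altSum_eval_of_degree_lt y (q := r * s * (1 - Polynomial.X) ^ e)]
  · congr 1
    ext i
    simp only [Polynomial.eval_mul, hr', hs', Polynomial.eval_pow, Polynomial.eval_sub,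
      Polynomial.eval_one, Polynomial.eval_X, Nat.add_sub_cancel]
    ring
  · have h1 : (1 - Polynomial.X : Polynomial K).natDegree ≤ 1 := by
      compute_degree
    have h2 := Polynomial.natDegree_mul_le (p := r * s) (q := (1 - Polynomial.X) ^ e)
    have h3 := Polynomial.natDegree_mul_le (p := r) (q := s)
    have h4 := Polynomial.natDegree_pow_le_of_le e h1
    refine Polynomial.degree_le_natDegree.trans_lt (Nat.cast_lt.mpr ?_)
    omega

end Field

theorem altSum_grothPoly_mul_grothPoly_of_isDomain {A : Type*} [CommRing A] [IsDomain A] {d : ℕ}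
    {y : Fin (d + 1) → A} (hy : Function.Injective y) {a b : Fin d → ℕ}
    (ha : Antitone a) (hb : Antitone b) {p q : ℕ} (hp : ∀ j : Fin d, p ≤ j → a j = 0)
    (hq : ∀ j : Fin d, q ≤ j → b j = 0) (hpq : p + q < d) :
    altSum y 0 (fun i => (1 - y i) ^ (d - 1) *
      (grothPoly d (y ∘ i.succAbove) a * grothPoly d (y ∘ i.succAbove) b)) = 0 := by
  have hinj := IsFractionRing.injective A (FractionRing A)
  have h := altSum_grothPoly_mul_grothPoly (hinj.comp hy) ha hb hp hq hpq
  apply hinj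
  rw [map_zero, ← h, altSum_apply, altSum_apply, map_sum]
  refine Finset.sum_congr rfl fun i _ => ?_
  simp only [map_mul, map_pow, map_neg, map_one, map_sub, map_altDet, map_grothPoly]
  rfl

/-- The restriction of `stableG` to the first `N` variables (for at most `N` rows). -/
noncomputable def restrictedG (N : ℕ) (mu : YoungDiagram) : MvPolynomial ℕ ℂ :=
  grothPoly N (fun i : Fin N => (MvPolynomial.X (i : ℕ) : MvPolynomial ℕ ℂ)) (parts N mu)

theorem pow_dvd_of_coeff_eq_zero {A : Type*} [CommRing A] (φ : MvPolynomial ℕ ℂ →+* A) {t : A}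
    (ht : ∀ j, t ∣ φ (MvPolynomial.X j)) {P : MvPolynomial ℕ ℂ} {k : ℕ}
    (hP : ∀ m : ℕ →₀ ℕ, m.degree ≤ k → P.coeff m = 0) : t ^ (k + 1) ∣ φ P := by
  rw [← P.support_sum_monomial_coeff, map_sum]
  refine Finset.dvd_sum fun m hm => ?_
  have hdeg : k + 1 ≤ m.degree := by
    by_contra! hc
    exact MvPolynomial.mem_support_iff.mp hm (hP m (by omega))
  rw [MvPolynomial.monomial_eq, map_mul, Finsupp.prod, map_prod]
  refine Dvd.dvd.mul_left ((pow_dvd_pow t hdeg).trans ?_) _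
  rw [Finsupp.degree_apply, ← Finset.prod_pow_eq_pow_sum]
  refine Finset.prod_dvd_prod_of_dvd _ _ fun j _ => ?_
  rw [map_pow]
  exact pow_dvd_pow_of_dvd (ht j) _

/-- The substitution `X j ↦ T * X j`. -/
noncomputable def scaleHom : MvPolynomial ℕ ℂ →+* Polynomial (MvPolynomial ℕ ℂ) :=
  MvPolynomial.eval₂Hom (Polynomial.C.comp MvPolynomial.C)
    fun j => Polynomial.X * Polynomial.C (MvPolynomial.X j)

theorem scaleHom_monomial (m : ℕ →₀ ℕ) (c : ℂ) : scaleHom (MvPolynomial.monomial m c) =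
    Polynomial.monomial m.degree (MvPolynomial.monomial m c) := by
  rw [scaleHom, MvPolynomial.coe_eval₂Hom, MvPolynomial.eval₂_monomial,
    ← Polynomial.C_mul_X_pow_eq_monomial, MvPolynomial.monomial_eq, map_mul, Finsupp.degree_apply,
    Finsupp.prod, Finsupp.prod, map_prod, ← Finset.prod_pow_eq_pow_sum, mul_assoc,
    ← Finset.prod_mul_distrib, RingHom.comp_apply]
  congr 1
  refine Finset.prod_congr rfl fun j _ => ?_
  rw [mul_pow, map_pow, mul_comm]

theorem coeff_coeff_scaleHom (P : MvPolynomial ℕ ℂ) (m : ℕ →₀ ℕ) :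
    ((scaleHom P).coeff m.degree).coeff m = P.coeff m := by
  induction P using MvPolynomial.induction_on' with
  | monomial n c =>
    rw [scaleHom_monomial, Polynomial.coeff_monomial]
    split_ifs with h
    · rfl
    · rw [MvPolynomial.coeff_zero, MvPolynomial.coeff_monomial, if_neg]
      rintro rfl
      exact h rfl
  | add p q hp hq => rw [map_add, Polynomial.coeff_add, MvPolynomial.coeff_add, hp, hq,
      MvPolynomial.coeff_add]

theorem rowLen_eq_zero_of_le {mu : YoungDiagram} {r s : ℕ} (h : mu.rowLen r = 0) (hrs : r ≤ s) :
    mu.rowLen s = 0 := by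
  have := mu.rowLen_anti r s hrs
  omega

/-- The remainder of a product after subtracting a combination of stable Grothendieck
polynomials, in `N` variables. -/
def grothRemainder {A : Type*} [CommRing A] (ι : ℂ →+* A) (lam mu : YoungDiagram)
    (S : Finset YoungDiagram) (c : YoungDiagram → ℂ) (N : ℕ) (x : Fin N → A) : A :=
  grothPoly N x (parts N lam) * grothPoly N x (parts N mu) -
    ∑ kappa ∈ S, ι (c kappa) * grothPoly N x (parts N kappa)

section Remainder

variable {A : Type*} [CommRing A] {lam mu : YoungDiagram} {S : Finset YoungDiagram}
  {c : YoungDiagram → ℂ} {e p q : ℕ}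

theorem map_grothRemainder {B : Type*} [CommRing B] (f : A →+* B) (ι : ℂ →+* A) (N : ℕ)
    (x : Fin N → A) : f (grothRemainder ι lam mu S c N x) =
      grothRemainder (f.comp ι) lam mu S c N (f ∘ x) := by
  simp only [grothRemainder, map_sub, map_mul, map_sum, map_grothPoly, RingHom.comp_apply]

theorem grothRemainder_of_last_eq_zero (ι : ℂ →+* A) (hlam : lam.rowLen e = 0)
    (hmu : mu.rowLen e = 0) (hS : ∀ kappa ∈ S, kappa.rowLen e = 0) (x : Fin (e + 1) → A)
    (hx : x (Fin.last e) = 0) : grothRemainder ι lam mu S c (e + 1) x =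
      grothRemainder ι lam mu S c e (x ∘ Fin.castSucc) := by
  have h : ∀ nu : YoungDiagram, nu.rowLen e = 0 →
      grothPoly (e + 1) x (parts (e + 1) nu) = grothPoly e (x ∘ Fin.castSucc) (parts e nu) :=
    fun nu hnu => grothPoly_succ_of_last_eq_zero x hx _ (parts_antitone _ _) hnu
  rw [grothRemainder, grothRemainder, h lam hlam, h mu hmu]
  congr 1
  exact Finset.sum_congr rfl fun kappa hkappa => by rw [h kappa (hS kappa hkappa)]

theorem altSum_grothRemainder [IsDomain A] (ι : ℂ →+* A) (hlam : lam.rowLen p = 0)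
    (hmu : mu.rowLen q = 0) (hpq : p + q ≤ e) (hS : ∀ kappa ∈ S, kappa.rowLen e = 0)
    {y : Fin (e + 2) → A} (hy : Function.Injective y) :
    altSum y 0 (fun i => (1 - y i) ^ e *
      grothRemainder ι lam mu S c (e + 1) (y ∘ i.succAbove)) = 0 := by
  have h1 := altSum_grothPoly_mul_grothPoly_of_isDomain hy (parts_antitone (e + 1) lam)
    (parts_antitone (e + 1) mu) (p := p) (q := q) (fun j hj => rowLen_eq_zero_of_le hlam hj)
    (fun j hj => rowLen_eq_zero_of_le hmu hj) (by omega)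
  have h2 : ∀ kappa ∈ S, altSum y 0 (fun i => (1 - y i) ^ (e + 1 - 1) *
      (grothPoly (e + 1) (y ∘ i.succAbove) (parts (e + 1) kappa) *
        grothPoly (e + 1) (y ∘ i.succAbove) 0)) = 0 := fun kappa hkappa =>
    altSum_grothPoly_mul_grothPoly_of_isDomain hy (parts_antitone (e + 1) kappa)
    antitone_const (p := e) (q := 0) (fun j hj => rowLen_eq_zero_of_le (hS kappa hkappa) hj)
    (fun _ _ => rfl) (by omega)
  have h3 : (fun i => (1 - y i) ^ e * grothRemainder ι lam mu S c (e + 1) (y ∘ i.succAbove)) =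
      (fun i => (1 - y i) ^ (e + 1 - 1) *
        (grothPoly (e + 1) (y ∘ i.succAbove) (parts (e + 1) lam) *
          grothPoly (e + 1) (y ∘ i.succAbove) (parts (e + 1) mu))) -
      ∑ kappa ∈ S, ι (c kappa) • fun i => (1 - y i) ^ (e + 1 - 1) *
        (grothPoly (e + 1) (y ∘ i.succAbove) (parts (e + 1) kappa) *
          grothPoly (e + 1) (y ∘ i.succAbove) 0) := by
    ext1 i
    simp only [grothRemainder, Pi.sub_apply, Finset.sum_apply, Pi.smul_apply, smul_eq_mul,
      grothPoly_zero_eq_one, mul_one, Nat.add_sub_cancel, mul_sub, Finset.mul_sum]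
    congr 1
    exact Finset.sum_congr rfl fun _ _ => mul_left_comm _ _ _
  rw [h3, map_sub, h1, map_sum, Finset.sum_eq_zero, sub_zero]
  intro kappa hkappa
  rw [map_smul, h2 kappa hkappa, smul_zero]

theorem pow_dvd_grothRemainder [IsDomain A] (ι : ℂ →+* A) (hlam : lam.rowLen p = 0)
    (hmu : mu.rowLen q = 0) (hpq : p + q ≤ e) (hS : ∀ kappa ∈ S, kappa.rowLen e = 0) {t : A}
    (ht : Prime t) {z : Fin (e + 2) → A} (hz : Function.Injective z) (hz0 : z (Fin.last _) = 0)
    (hzt : ¬ t ∣ altDet (z ∘ Fin.castSucc) 0) {k : ℕ}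
    (hk : ∀ x : Fin e → A, (∀ j, t ∣ x j) → t ^ (k + 1) ∣ grothRemainder ι lam mu S c e x) :
    t ^ (k + 1) ∣ grothRemainder ι lam mu S c (e + 1) fun i => t * z i.castSucc := by
  let y : Fin (e + 2) → A := fun i => t * z i
  have hy : Function.Injective y := fun i j h => hz (mul_left_cancel₀ ht.ne_zero h)
  have hy0 : y (Fin.last _) = 0 := by simp only [y, hz0, mul_zero]
  have hrel := altSum_grothRemainder (c := c) ι hlam hmu hpq hS hy
  rw [altSum_apply, Fin.sum_univ_castSucc] at hrel
  have hdet : ∀ i : Fin (e + 2), altDet (y ∘ i.succAbove) 0 =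
      t ^ ((e + 1).choose 2) * altDet (z ∘ i.succAbove) 0 := fun i =>
    altDet_zero_smul t (z ∘ i.succAbove)
  have hterm : ∀ i : Fin (e + 1),
      t ^ (k + 1) ∣ grothRemainder ι lam mu S c (e + 1) (y ∘ i.castSucc.succAbove) := by
    intro i
    rw [grothRemainder_of_last_eq_zero ι (rowLen_eq_zero_of_le hlam (by omega))
      (rowLen_eq_zero_of_le hmu (by omega)) hS _ (by
        rw [Function.comp_apply, Fin.succAbove_ne_last_last (Fin.castSucc_lt_last i).ne, hy0])]
    exact hk _ fun j => dvd_mul_right _ _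
  have hcs : (Fin.last (e + 1)).succAbove = Fin.castSucc := Fin.succAbove_last
  rw [hy0, hdet (Fin.last (e + 1)), hcs, sub_zero, one_pow, one_mul] at hrel
  have hlast : t ^ ((e + 1).choose 2) * t ^ (k + 1) ∣ (-1) ^ (e + 1) *
      (t ^ ((e + 1).choose 2) * (altDet (z ∘ Fin.castSucc) 0 *
        grothRemainder ι lam mu S c (e + 1) (y ∘ Fin.castSucc))) := by
    rw [Fin.val_last, mul_assoc, mul_assoc] at hrel
    rw [eq_neg_of_add_eq_zero_right hrel, dvd_neg]
    refine Finset.dvd_sum fun i _ => ?_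
    rw [hdet]
    obtain ⟨u, hu⟩ := hterm i
    rw [hu]
    exact ⟨(-1) ^ (i : ℕ) * altDet (z ∘ i.castSucc.succAbove) 0 * (1 - y i.castSucc) ^ e * u, by
      rw [Fin.val_castSucc]; ring⟩
  have hsign : IsUnit ((-1 : A) ^ (e + 1)) := isUnit_one.neg.pow _
  rw [hsign.dvd_mul_left, mul_dvd_mul_iff_left (pow_ne_zero _ ht.ne_zero)] at hlast
  exact ht.pow_dvd_of_dvd_mul_left _ hzt hlast

/-- If a product of stable Grothendieck polynomials with few rows, minus a combination of such
polynomials, vanishes to some order in `e` variables, then it does so in `e + 1` variables. -/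
theorem coeff_grothRemainder_eq_zero (hlam : lam.rowLen p = 0)
    (hmu : mu.rowLen q = 0) (hpq : p + q ≤ e) (hS : ∀ kappa ∈ S, kappa.rowLen e = 0) {k : ℕ}
    (hk : ∀ m : ℕ →₀ ℕ, m.degree ≤ k → (grothRemainder MvPolynomial.C lam mu S c e
      fun i => (MvPolynomial.X (i : ℕ) : MvPolynomial ℕ ℂ)).coeff m = 0)
    (m : ℕ →₀ ℕ) (hm : m.degree ≤ k) : (grothRemainder MvPolynomial.C lam mu S c (e + 1)
      fun i => (MvPolynomial.X (i : ℕ) : MvPolynomial ℕ ℂ)).coeff m = 0 := by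
  let X' : Fin (e + 1) → MvPolynomial ℕ ℂ := fun i => MvPolynomial.X (i : ℕ)
  have hX' : Function.Injective X' := fun i j h => Fin.ext (MvPolynomial.X_injective h)
  let z : Fin (e + 2) → Polynomial (MvPolynomial ℕ ℂ) :=
    Fin.snoc (α := fun _ => Polynomial (MvPolynomial ℕ ℂ)) (fun i => Polynomial.C (X' i)) 0
  have hzc : ∀ i : Fin (e + 1), z i.castSucc = Polynomial.C (X' i) := fun i => by
    simp only [z, Fin.snoc_castSucc]
  have hz0 : z (Fin.last _) = 0 := by simp only [z, Fin.snoc_last]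
  have hne : ∀ i : Fin (e + 1), Polynomial.C (X' i) ≠ 0 := fun i h =>
    MvPolynomial.X_ne_zero _ (Polynomial.C_eq_zero.mp h)
  have hz : Function.Injective z := by
    intro i j h
    induction i using Fin.lastCases with
    | last =>
      induction j using Fin.lastCases with
      | last => rfl
      | cast j => rw [hz0, hzc] at h; exact absurd h.symm (hne j)
    | cast i =>
      induction j using Fin.lastCases with
      | last => rw [hz0, hzc] at h; exact absurd h (hne i)
      | cast j => rw [hzc, hzc] at h; rw [hX' (Polynomial.C_injective h)]
  have hdvd := pow_dvd_grothRemainder (c := c)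
    ((Polynomial.C : MvPolynomial ℕ ℂ →+* _).comp MvPolynomial.C) hlam hmu hpq hS
    Polynomial.prime_X hz hz0 (k := k) ?_ ?_
  · have hscale : (grothRemainder
        ((Polynomial.C : MvPolynomial ℕ ℂ →+* _).comp MvPolynomial.C) lam mu S c (e + 1)
        fun i => Polynomial.X * z i.castSucc) = scaleHom (grothRemainder MvPolynomial.C lam mu S c
          (e + 1) X') := by
      rw [map_grothRemainder]
      congr 1
      · ext a
        simp [scaleHom]
      · ext1 i
        simp [hzc, scaleHom, X']
    rw [hscale] at hdvd
    rw [← coeff_coeff_scaleHom, Polynomial.X_pow_dvd_iff.mp hdvd _ (by omega),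
      MvPolynomial.coeff_zero]
  · have h1 : z ∘ Fin.castSucc = Polynomial.C ∘ X' := funext hzc
    rw [h1, ← map_altDet, Polynomial.X_dvd_iff, Polynomial.coeff_C_zero]
    exact altDet_zero_ne_zero X' hX'
  · intro x hx
    let f : MvPolynomial ℕ ℂ →+* Polynomial (MvPolynomial ℕ ℂ) :=
      MvPolynomial.eval₂Hom (Polynomial.C.comp MvPolynomial.C)
        fun j => if h : j < e then x ⟨j, h⟩ else 0
    have h1 := pow_dvd_of_coeff_eq_zero f (t := Polynomial.X) (fun j => by
      simp only [f, MvPolynomial.eval₂Hom_X']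
      split_ifs
      · exact hx _
      · exact dvd_zero _) hk
    rw [map_grothRemainder] at h1
    convert h1 using 2
    · ext a
      simp [f]
    · ext1 i
      simp [f]

end Remainder

theorem coeff_restrictedG {N : ℕ} {lam : YoungDiagram} (hN : lam.rowLen N = 0) {m : ℕ →₀ ℕ}
    (hm : ∀ k, N ≤ k → m k = 0) :
    (restrictedG N lam).coeff m = MvPowerSeries.coeff m (stableG lam) := coeff_grothPoly hN hm

theorem coeff_restrictedG_mul {N : ℕ} {lam mu : YoungDiagram} (hlam : lam.rowLen N = 0)
    (hmu : mu.rowLen N = 0) {m : ℕ →₀ ℕ} (hm : ∀ k, N ≤ k → m k = 0) :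
    (restrictedG N lam * restrictedG N mu).coeff m =
      MvPowerSeries.coeff m (stableG lam * stableG mu) := by
  classical
  rw [MvPolynomial.coeff_mul, MvPowerSeries.coeff_mul]
  refine Finset.sum_congr rfl fun x hx => ?_
  rw [HasAntidiagonal.mem_antidiagonal] at hx
  have h : ∀ k, N ≤ k → x.1 k = 0 ∧ x.2 k = 0 := by
    intro k hk
    have := hm k hk
    rw [← hx, Finsupp.add_apply] at this
    omega
  rw [coeff_restrictedG hlam fun k hk => (h k hk).1, coeff_restrictedG hmu fun k hk => (h k hk).2]

theorem coeff_grothRemainder {N : ℕ} {lam mu : YoungDiagram} {S : Finset YoungDiagram}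
    {c : YoungDiagram → ℂ} (hlam : lam.rowLen N = 0) (hmu : mu.rowLen N = 0)
    (hS : ∀ kappa ∈ S, kappa.rowLen N = 0) {m : ℕ →₀ ℕ} (hm : ∀ k, N ≤ k → m k = 0) :
    (grothRemainder MvPolynomial.C lam mu S c N
      fun i => (MvPolynomial.X (i : ℕ) : MvPolynomial ℕ ℂ)).coeff m =
      MvPowerSeries.coeff m (stableG lam * stableG mu) -
        ∑ kappa ∈ S, c kappa * MvPowerSeries.coeff m (stableG kappa) := by
  rw [grothRemainder, MvPolynomial.coeff_sub, MvPolynomial.coeff_sum,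
    ← coeff_restrictedG_mul hlam hmu hm]
  congr 1
  refine Finset.sum_congr rfl fun kappa hkappa => ?_
  rw [MvPolynomial.coeff_C_mul, ← coeff_restrictedG (hS kappa hkappa) hm]
  rfl

theorem coeff_grothRemainder_of_ne_zero {N : ℕ} {lam mu : YoungDiagram} {S : Finset YoungDiagram}
    {c : YoungDiagram → ℂ} {m : ℕ →₀ ℕ} {k : ℕ} (hk : N ≤ k) (hm : m k ≠ 0) :
    (grothRemainder MvPolynomial.C lam mu S c N
      fun i => (MvPolynomial.X (i : ℕ) : MvPolynomial ℕ ℂ)).coeff m = 0 := by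
  have h := map_grothRemainder (lam := lam) (mu := mu) (S := S) (c := c)
    (MvPolynomial.rename (R := ℂ) (Fin.val : Fin N → ℕ)).toRingHom MvPolynomial.C N MvPolynomial.X
  have h1 : (MvPolynomial.rename (R := ℂ) (Fin.val : Fin N → ℕ)).toRingHom.comp MvPolynomial.C =
      MvPolynomial.C := by
    ext a : 1; simp
  have h2 : ((MvPolynomial.rename (R := ℂ) (Fin.val : Fin N → ℕ)).toRingHom ∘ MvPolynomial.X) =
      fun i : Fin N => MvPolynomial.X (i : ℕ) := by
    ext i : 1; simp
  rw [h1, h2] at h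
  rw [← h]
  refine MvPolynomial.coeff_rename_eq_zero _ _ _ fun u hu => ?_
  exfalso
  apply hm
  rw [← hu, Finsupp.mapDomain_of_notMem_range]
  rintro ⟨i, rfl⟩
  omega

section Finiteness

variable {g : YoungDiagram → SymFun} (hg : IsDualFamily g) {lam mu : YoungDiagram}

include hg

theorem hall_mul_eq_zero_of_rowLen_zero_lt {nu : YoungDiagram}
    (h : lam.rowLen 0 + mu.rowLen 0 < nu.rowLen 0) :
    hall (g nu) (stableG lam * stableG mu) = 0 := by
  classical
  induction hr : rank nu using Nat.strong_induction_on generalizing nu with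
  | _ r ih =>
  subst hr
  have h0 : MvPowerSeries.coeff (rowExponent nu) (stableG lam * stableG mu) = 0 := by
    rw [MvPowerSeries.coeff_mul]
    refine Finset.sum_eq_zero fun x hx => ?_
    rw [HasAntidiagonal.mem_antidiagonal] at hx
    by_contra hc
    obtain ⟨T, hT⟩ := coeff_stableG_ne_zero (left_ne_zero_of_mul hc)
    obtain ⟨T', hT'⟩ := coeff_stableG_ne_zero (right_ne_zero_of_mul hc)
    have h1 := T.content_le_rowLen 0
    have h2 := T'.content_le_rowLen 0
    have h3 := rowExponent_apply nu 0
    rw [← hx, Finsupp.add_apply, ← hT, ← hT'] at h3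
    omega
  rw [hg.coeff_eq_sum ((isSymm_stableG lam).mul (isSymm_stableG mu)) (rowExponent nu)
    (S := (finite_card_le nu.card).toFinset) (fun kappa hk => by
      simpa [degree_rowExponent] using hk),
    Finset.sum_eq_single_of_mem nu (by simp), coeff_stableG_rowExponent_self, mul_one] at h0
  · exact h0
  · intro kappa _ hne
    by_contra hc
    have hc' := right_ne_zero_of_mul hc
    rcases eq_or_rank_lt_of_coeff_ne_zero hc' with h1 | h1
    · exact hne h1
    · refine left_ne_zero_of_mul hc (ih _ h1 ?_ rfl)
      obtain ⟨T, hT⟩ := coeff_stableG_ne_zero hc'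
      have h2 := T.content_le_rowLen 0
      rw [hT, rowExponent_apply] at h2
      omega

theorem hall_mul_eq_zero_of_rowLen_ne_zero {p q : ℕ} (hlam : lam.rowLen p = 0)
    (hmu : mu.rowLen q = 0) {nu : YoungDiagram} (h : nu.rowLen (p + q) ≠ 0) :
    hall (g nu) (stableG lam * stableG mu) = 0 := by
  classical
  induction hr : rank nu using Nat.strong_induction_on generalizing nu with
  | _ r ih =>
  subst hr
  obtain ⟨e, he, he'⟩ : ∃ e, nu.rowLen e ≠ 0 ∧ nu.rowLen (e + 1) = 0 := by
    obtain ⟨N, hN⟩ := exists_rowLen_eq_zero nu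
    by_contra! hc
    have : ∀ e, p + q ≤ e → nu.rowLen e ≠ 0 := fun e he => by
      induction e, he using Nat.le_induction with
      | base => exact h
      | succ e _ ih => exact hc e ih
    exact this (max N (p + q)) (le_max_right _ _) (hN _ (le_max_left _ _))
  have hpe : p + q ≤ e := by
    by_contra! hc
    exact h (rowLen_eq_zero_of_le he' hc)
  set f := stableG lam * stableG mu with hf
  have hsymm : IsSymm f := (isSymm_stableG lam).mul (isSymm_stableG mu)
  set B := (finite_card_le nu.card).toFinset with hB
  have hBmem : ∀ kappa, kappa ∈ B ↔ kappa.card ≤ nu.card := fun kappa => by simp [hB]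
  set S := B.filter fun kappa => kappa.rowLen e = 0 with hSdef
  have hS : ∀ kappa ∈ S, kappa.rowLen e = 0 := fun kappa hk => (mem_filter.mp hk).2
  have hkey := coeff_grothRemainder_eq_zero (c := fun kappa => hall (g kappa) f) hlam hmu hpe hS
    (k := nu.card) (fun m hm => by
      by_cases hsupp : ∀ k, e ≤ k → m k = 0
      · rw [coeff_grothRemainder (rowLen_eq_zero_of_le hlam (by omega))
          (rowLen_eq_zero_of_le hmu (by omega)) hS hsupp, ← hf,
          hg.coeff_eq_sum hsymm m (S := B) (fun kappa hk => (hBmem kappa).mpr (hk.trans hm)),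
          sub_eq_zero, hSdef, Finset.sum_filter_of_ne]
        intro kappa _ hc
        by_contra hrow
        exact right_ne_zero_of_mul hc (coeff_stableG_eq_zero hrow hsupp)
      · push Not at hsupp
        obtain ⟨k, hk, hmk⟩ := hsupp
        exact coeff_grothRemainder_of_ne_zero hk hmk)
    (rowExponent nu) (degree_rowExponent nu).le
  rw [coeff_grothRemainder (rowLen_eq_zero_of_le hlam (by omega))
    (rowLen_eq_zero_of_le hmu (by omega))
    (fun kappa hk => rowLen_eq_zero_of_le (hS kappa hk) (Nat.le_succ e))
    (fun k hk => by rw [rowExponent_apply]; exact rowLen_eq_zero_of_le he' hk), ← hf,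
    hg.coeff_eq_sum hsymm (rowExponent nu) (S := B)
      (fun kappa hk => (hBmem kappa).mpr (by rwa [degree_rowExponent] at hk)),
    ← Finset.sum_filter_add_sum_filter_not B (fun kappa => kappa.rowLen e = 0), ← hSdef,
    add_sub_cancel_left, Finset.sum_eq_single_of_mem nu, coeff_stableG_rowExponent_self,
    mul_one] at hkey
  · exact hkey
  · exact mem_filter.mpr ⟨(hBmem nu).mpr le_rfl, he⟩
  · intro kappa hk hne
    by_contra hc
    rcases eq_or_rank_lt_of_coeff_ne_zero (right_ne_zero_of_mul hc) with h1 | h1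
    · exact hne h1
    · refine left_ne_zero_of_mul hc (ih _ h1 (fun h2 => ?_) rfl)
      exact (mem_filter.mp hk).2 (rowLen_eq_zero_of_le h2 hpe)

theorem finite_hall_mul_ne_zero :
    {nu | hall (g nu) (stableG lam * stableG mu) ≠ 0}.Finite := by
  obtain ⟨p, hp⟩ := exists_rowLen_eq_zero lam
  obtain ⟨q, hq⟩ := exists_rowLen_eq_zero mu
  refine (finite_le (rect (p + q) (lam.rowLen 0 + mu.rowLen 0))).subset fun nu hnu => ?_
  refine le_rect ?_ ?_
  · by_contra hc
    exact hnu (hall_mul_eq_zero_of_rowLen_ne_zero hg (hp p le_rfl) (hq q le_rfl) hc)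
  · by_contra! hc
    exact hnu (hall_mul_eq_zero_of_rowLen_zero_lt hg hc)

theorem IsLRFamily.hall_eq {c : YoungDiagram →₀ ℤ} (hc : IsLRFamily lam mu c)
    (nu : YoungDiagram) : hall (g nu) (stableG lam * stableG mu) =
      (-1 : ℂ) ^ ((nu.card : ℤ) - (lam.card : ℤ) - (mu.card : ℤ)) * (c nu : ℂ) := by
  classical
  rw [hc, ← hallRight_apply, Finsupp.sum, map_sum]
  simp only [map_smul, hallRight_apply, hg nu, smul_eq_mul, mul_ite, mul_one, mul_zero]
  rw [Finset.sum_ite_eq]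
  split_ifs with h
  · rfl
  · rw [Finsupp.notMem_support_iff.mp h, Int.cast_zero, mul_zero]

theorem existsUnique_isLRFamily : ∃! c : YoungDiagram →₀ ℤ, IsLRFamily lam mu c := by
  classical
  have hsign : ∀ k : ℤ, (-1 : ℂ) ^ k * (-1 : ℂ) ^ k = 1 := fun k => by
    rw [← mul_zpow, neg_one_mul, neg_neg, one_zpow]
  have hsign0 : ∀ k : ℤ, (-1 : ℂ) ^ k ≠ 0 := fun k => zpow_ne_zero k (by norm_num)
  have hint : ∀ nu, ∃ z : ℤ, (z : ℂ) = (-1 : ℂ) ^ ((nu.card : ℤ) - (lam.card : ℤ) - (mu.card : ℤ)) *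
      hall (g nu) (stableG lam * stableG mu) := by
    intro nu
    obtain ⟨z, hz⟩ := hg.hall_mem_range nu
      ((hasIntCoeffs_stableG lam).mul (hasIntCoeffs_stableG mu))
    refine ⟨(((-1 : ℤˣ) ^ ((nu.card : ℤ) - (lam.card : ℤ) - (mu.card : ℤ)) : ℤˣ) : ℤ) * z, ?_⟩
    rw [← hz]
    rcases Int.even_or_odd ((nu.card : ℤ) - (lam.card : ℤ) - (mu.card : ℤ)) with h | h
    · simp [h.neg_one_zpow]
    · simp [h.neg_one_zpow]
  choose z hz using hint
  have hz0 : ∀ nu, z nu ≠ 0 → hall (g nu) (stableG lam * stableG mu) ≠ 0 := by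
    intro nu h h0
    apply h
    have := hz nu
    rw [h0, mul_zero] at this
    exact_mod_cast this
  let c : YoungDiagram →₀ ℤ := Finsupp.ofSupportFinite z
    ((finite_hall_mul_ne_zero hg (lam := lam) (mu := mu)).subset fun nu h => hz0 nu h)
  have hc : ∀ nu, c nu = z nu := fun nu => rfl
  refine ⟨c, ?_, fun c' hc' => ?_⟩
  · change stableG lam * stableG mu = _
    ext m
    rw [hg.coeff_eq_sum ((isSymm_stableG lam).mul (isSymm_stableG mu)) m
      (S := (finite_card_le m.degree).toFinset ∪ c.support) (fun kappa hk =>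
        mem_union_left _ (by simpa using hk)),
      Finsupp.sum_of_support_subset c Finset.subset_union_right _ (by simp), map_sum]
    refine Finset.sum_congr rfl fun nu _ => ?_
    rw [map_smul, smul_eq_mul, hc, hz, ← mul_assoc, hsign, one_mul]
  · ext nu
    have h := hc'.hall_eq hg nu
    rw [← mul_right_inj' (hsign0 _), ← mul_assoc, hsign, one_mul] at h
    rw [hc]
    exact_mod_cast h.symm.trans (hz nu).symm

end Finiteness

theorem det_eq_zero_of_zero_block {R : Type*} [CommRing R] {N : ℕ}
    (M : Matrix (Fin N) (Fin N) R) (I J : Finset (Fin N)) (hcard : N < I.card + J.card)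
    (h : ∀ i ∈ I, ∀ j ∈ J, M i j = 0) : M.det = 0 := by
  rw [Matrix.det_apply]
  refine Finset.sum_eq_zero fun σ _ => ?_
  obtain ⟨j, hj, hσ⟩ : ∃ j ∈ J, σ j ∈ I := by
    by_contra! hc
    have hdisj : Disjoint I (J.image σ) := by
      rw [Finset.disjoint_left]
      intro i hi hi'
      obtain ⟨j, hj, rfl⟩ := mem_image.mp hi'
      exact hc j hj hi
    have h1 := Finset.card_le_univ (I ∪ J.image σ)
    rw [Finset.card_union_of_disjoint hdisj, Finset.card_image_of_injective _ σ.injective,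
      Fintype.card_fin] at h1
    omega
  have h0 : ∏ i, M (σ i) i = 0 := Finset.prod_eq_zero (mem_univ j) (h _ hσ _ hj)
  rw [h0, smul_zero]

section Residue

variable {N : ℕ}

/-- The linear functional on polynomials in one variable with moments `t`. -/
def momentFunctional (t : ℕ → ℂ) : Polynomial ℂ →ₗ[ℂ] ℂ where
  toFun f := f.sum fun k a => a * t k
  map_add' f g := Polynomial.sum_add_index f g _ (by simp) (by simp [add_mul])
  map_smul' c f := by
    rw [Polynomial.sum_smul_index _ _ _ (by simp), Polynomial.sum_def, Polynomial.sum_def,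
      smul_eq_mul, Finset.mul_sum]
    exact Finset.sum_congr rfl fun _ _ => mul_assoc _ _ _

/-- The linear functional on polynomials with product moments `t`. -/
noncomputable def productFunctional (N : ℕ) (t : ℕ → ℂ) : MvPolynomial (Fin N) ℂ →ₗ[ℂ] ℂ :=
  (MvPolynomial.basisMonomials (Fin N) ℂ).constr ℂ fun m => ∏ i, t (m i)

theorem productFunctional_monomial (t : ℕ → ℂ) (m : Fin N →₀ ℕ) (c : ℂ) :
    productFunctional N t (MvPolynomial.monomial m c) = c * ∏ i, t (m i) := by
  have : MvPolynomial.monomial m c = c • MvPolynomial.basisMonomials (Fin N) ℂ m := by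
    rw [MvPolynomial.coe_basisMonomials, MvPolynomial.smul_monomial, smul_eq_mul, mul_one]
  rw [this, map_smul, productFunctional, Module.Basis.constr_basis, smul_eq_mul]

theorem productFunctional_prod (t : ℕ → ℂ) (f : Fin N → Polynomial ℂ) :
    productFunctional N t (∏ i, Polynomial.aeval (MvPolynomial.X i) (f i)) =
      ∏ i, momentFunctional t (f i) := by
  have h1 : ∀ i, Polynomial.aeval (MvPolynomial.X i : MvPolynomial (Fin N) ℂ) (f i) =
      ∑ k ∈ (f i).support, MvPolynomial.monomial (Finsupp.single i k) ((f i).coeff k) := by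
    intro i
    rw [Polynomial.aeval_def, Polynomial.eval₂_eq_sum, Polynomial.sum_def]
    refine Finset.sum_congr rfl fun k _ => ?_
    rw [MvPolynomial.X_pow_eq_monomial, MvPolynomial.algebraMap_eq, MvPolynomial.C_mul_monomial,
      mul_one]
  have h2 : ∀ i, momentFunctional t (f i) = ∑ k ∈ (f i).support, (f i).coeff k * t k := fun i => rfl
  simp only [h1, h2, Finset.prod_univ_sum]
  rw [map_sum]
  refine Finset.sum_congr rfl fun k _ => ?_
  have h3 : ∀ s : Finset (Fin N),
      ∏ i ∈ s, MvPolynomial.monomial (Finsupp.single i (k i)) ((f i).coeff (k i)) =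
        MvPolynomial.monomial (∑ i ∈ s, Finsupp.single i (k i)) (∏ i ∈ s, (f i).coeff (k i)) := by
    intro s
    induction s using Finset.induction_on with
    | empty => simp
    | insert i s hi ih =>
      rw [prod_insert hi, sum_insert hi, prod_insert hi, ih, MvPolynomial.monomial_mul]
  rw [h3, productFunctional_monomial, Finset.prod_mul_distrib]
  congr 1
  refine Finset.prod_congr rfl fun i _ => ?_
  rw [Finsupp.finsetSum_apply, Finset.sum_eq_single i] <;> simp +contextual

/-- Andréief's identity. -/
theorem productFunctional_det_mul_det (t : ℕ → ℂ) (u v : Fin N → Polynomial ℂ) :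
    productFunctional N t
      ((Matrix.of fun j i => Polynomial.aeval (MvPolynomial.X i) (u j)).det *
        (Matrix.of fun j i => Polynomial.aeval (MvPolynomial.X i) (v j)).det) =
      N.factorial * (Matrix.of fun j k => momentFunctional t (u j * v k)).det := by
  set M : Matrix (Fin N) (Fin N) ℂ := Matrix.of fun j k => momentFunctional t (u j * v k) with hM
  have h1 : ∀ σ τ : Equiv.Perm (Fin N), productFunctional N t
      ((Equiv.Perm.sign σ • ∏ i, Polynomial.aeval (MvPolynomial.X i) (u (σ i))) *
        (Equiv.Perm.sign τ • ∏ i, Polynomial.aeval (MvPolynomial.X i) (v (τ i)))) =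
      ((Equiv.Perm.sign σ : ℤ) : ℂ) * (Equiv.Perm.sign τ • ∏ i, (M.submatrix σ id) i (τ i)) := by
    intro σ τ
    have h : (∏ i, Polynomial.aeval (MvPolynomial.X i : MvPolynomial (Fin N) ℂ) (u (σ i))) *
        ∏ i, Polynomial.aeval (MvPolynomial.X i) (v (τ i)) =
        ∏ i, Polynomial.aeval (MvPolynomial.X i) (u (σ i) * v (τ i)) := by
      simp only [map_mul, Finset.prod_mul_distrib]
    rw [smul_mul_assoc, mul_smul_comm, h, Units.smul_def, Units.smul_def, map_zsmul, map_zsmul,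
      productFunctional_prod, zsmul_eq_mul]
    rfl
  have h2 : ∀ σ : Equiv.Perm (Fin N),
      ∑ τ : Equiv.Perm (Fin N), ((Equiv.Perm.sign σ : ℤ) : ℂ) *
        (Equiv.Perm.sign τ • ∏ i, (M.submatrix σ id) i (τ i)) = M.det := by
    intro σ
    rw [← Finset.mul_sum]
    have : ∑ τ : Equiv.Perm (Fin N), (Equiv.Perm.sign τ • ∏ i, (M.submatrix σ id) i (τ i)) =
        (M.submatrix σ id).det := by
      rw [← Matrix.det_transpose, Matrix.det_apply]
      rfl
    rw [this, Matrix.det_permute, ← mul_assoc, ← Int.cast_mul, ← Units.val_mul, Int.units_mul_self]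
    simp
  simp only [Matrix.det_apply, Matrix.of_apply, Finset.sum_mul_sum, map_sum, h1]
  simp only [h2]
  rw [Finset.sum_const, Finset.card_univ, Fintype.card_perm, Fintype.card_fin, nsmul_eq_mul]
  rw [Matrix.det_apply]

/-- The coefficient functional `f ↦ [X ^ n] f / (1 - X) ^ r`. -/
noncomputable def residueMoment (n r : ℕ) (k : ℕ) : ℂ :=
  PowerSeries.coeff n (PowerSeries.X ^ k * (PowerSeries.invOneSubPow ℂ r : PowerSeries ℂ))

theorem momentFunctional_residueMoment (n r : ℕ) (f : Polynomial ℂ) :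
    momentFunctional (residueMoment n r) f =
      PowerSeries.coeff n ((f : PowerSeries ℂ) * (PowerSeries.invOneSubPow ℂ r : PowerSeries ℂ)) := by
  have h : (f : PowerSeries ℂ) = ∑ k ∈ f.support, PowerSeries.C (f.coeff k) * PowerSeries.X ^ k := by
    conv_lhs => rw [f.as_sum_support_C_mul_X_pow, ← Polynomial.coeToPowerSeries.ringHom_apply,
      map_sum]
    simp
  rw [h, Finset.sum_mul, map_sum]
  refine Finset.sum_congr rfl fun k _ => ?_
  rw [mul_assoc, PowerSeries.coeff_C_mul]
  rfl

theorem residue_eq_zero_of_lt {n r e s : ℕ} (h : n < e) :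
    momentFunctional (residueMoment n r) (Polynomial.X ^ e * (1 - Polynomial.X) ^ s) = 0 := by
  rw [momentFunctional_residueMoment, Polynomial.coe_mul, Polynomial.coe_pow, Polynomial.coe_X,
    mul_assoc, PowerSeries.coeff_X_pow_mul', if_neg (by omega)]

theorem residue_eq_coeff {n r e s : ℕ} (h : e ≤ n) :
    momentFunctional (residueMoment n r) (Polynomial.X ^ e * (1 - Polynomial.X) ^ (s + r)) =
      ((1 - Polynomial.X : Polynomial ℂ) ^ s).coeff (n - e) := by
  have h1 : (1 - PowerSeries.X : PowerSeries ℂ) ^ r *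
      (PowerSeries.invOneSubPow ℂ r : PowerSeries ℂ) = 1 := by
    rw [← PowerSeries.invOneSubPow_inv_eq_one_sub_pow]
    exact (PowerSeries.invOneSubPow ℂ r).inv_val
  rw [momentFunctional_residueMoment, Polynomial.coe_mul, Polynomial.coe_pow, Polynomial.coe_X,
    mul_assoc, PowerSeries.coeff_X_pow_mul', if_pos h, Polynomial.coe_pow, Polynomial.coe_sub,
    Polynomial.coe_one, Polynomial.coe_X, pow_add, mul_assoc, h1, mul_one,
    ← Polynomial.coeff_coe, Polynomial.coe_pow, Polynomial.coe_sub,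
    Polynomial.coe_one, Polynomial.coe_X]

theorem residue_eq_zero_of_gt {n r e s : ℕ} (h : e + s < n) :
    momentFunctional (residueMoment n r) (Polynomial.X ^ e * (1 - Polynomial.X) ^ (s + r)) = 0 := by
  rw [residue_eq_coeff (by omega)]
  refine Polynomial.coeff_eq_zero_of_natDegree_lt ?_
  have h1 : (1 - Polynomial.X : Polynomial ℂ).natDegree ≤ 1 := by compute_degree
  have := Polynomial.natDegree_pow_le_of_le s h1
  omega

/-- The pairing of two alternants under the residue functional. -/
theorem productFunctional_altDet_mul_altDet {m : ℕ} {a b : Fin N → ℕ} (ha : Antitone a)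
    (hb : Antitone b) :
    productFunctional N (residueMoment (m + (N - 1)) (N - 1))
      (altDet MvPolynomial.X a * altDet MvPolynomial.X b) =
    N.factorial * (((Equiv.Perm.sign (Fin.revPerm : Equiv.Perm (Fin N)) : ℤ) : ℂ) *
      if ∀ j, a j + b j.rev = m then 1 else 0) := by
  have h1 : ∀ c : Fin N → ℕ, altDet (MvPolynomial.X : Fin N → MvPolynomial (Fin N) ℂ) c =
      (Matrix.of fun j i : Fin N => Polynomial.aeval (MvPolynomial.X i : MvPolynomial (Fin N) ℂ)
        (Polynomial.X ^ (c j + (N - 1 - j)) * (1 - Polynomial.X) ^ (j : ℕ) :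
          Polynomial ℂ)).det := by
    intro c
    rw [altDet]
    congr 1
    ext j i : 2
    simp
  rw [h1, h1, productFunctional_det_mul_det]
  congr 1
  set M : Matrix (Fin N) (Fin N) ℂ := Matrix.of fun j k : Fin N =>
    momentFunctional (residueMoment (m + (N - 1)) (N - 1))
      (Polynomial.X ^ (a j + (N - 1 - j) + (b k.rev + k)) *
        (1 - Polynomial.X) ^ ((j : ℕ) + (N - 1 - k))) with hM
  have hsub : (Matrix.of fun j k : Fin N => momentFunctional
      (residueMoment (m + (N - 1)) (N - 1))
      (Polynomial.X ^ (a j + (N - 1 - j)) * (1 - Polynomial.X) ^ (j : ℕ) *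
        (Polynomial.X ^ (b k + (N - 1 - k)) * (1 - Polynomial.X) ^ (k : ℕ)))) =
      M.submatrix id Fin.revPerm := by
    ext j k
    simp only [hM, Matrix.submatrix_apply, Matrix.of_apply, id, Fin.revPerm_apply, Fin.rev_rev,
      Fin.val_rev]
    congr 1
    rw [mul_mul_mul_comm, ← pow_add, ← pow_add, show N - ((k : ℕ) + 1) = N - 1 - k by omega,
      show N - 1 - (N - 1 - (k : ℕ)) = k by omega]
  rw [hsub, Matrix.det_permute']
  congr 1
  have hhigh : ∀ j k : Fin N, j ≤ k → m + j < a j + b k.rev + k → M j k = 0 := by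
    intro j k hjk h
    refine residue_eq_zero_of_lt ?_
    omega
  have hlow : ∀ j k : Fin N, k ≤ j → a j + b k.rev < m → M j k = 0 := by
    intro j k hjk h
    have hjk : (k : ℕ) ≤ j := hjk
    simp only [hM, Matrix.of_apply]
    rw [show (j : ℕ) + (N - 1 - k) = (j - k) + (N - 1) by omega]
    refine residue_eq_zero_of_gt ?_
    omega
  have hbrev : ∀ {j k : Fin N}, j ≤ k → b j.rev ≤ b k.rev := fun h => hb (Fin.rev_le_rev.mpr h)
  split_ifs with h
  · rw [Matrix.det_of_isLowerTriangular]
    · refine Finset.prod_eq_one fun j _ => ?_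
      simp only [hM, Matrix.of_apply]
      have := h j
      have he : (j : ℕ) + (N - 1 - j) = 0 + (N - 1) := by omega
      rw [he, residue_eq_coeff (by omega), show m + (N - 1) - (a j + (N - 1 - j) + (b j.rev + j)) = 0
        by omega]
      simp
    · intro j k hjk
      have hjk : j < k := hjk
      have h1 := h j
      have h2 := hbrev hjk.le
      have h3 : (j : ℕ) < k := hjk
      exact hhigh j k hjk.le (by omega)
  · push Not at h
    obtain ⟨j, hj⟩ := h
    rcases lt_or_gt_of_ne hj with hj | hj
    · refine det_eq_zero_of_zero_block M (Finset.Ici j) (Finset.Iic j) ?_ ?_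
      · rw [Fin.card_Ici, Fin.card_Iic]; omega
      · intro i hi k hk
        rw [Finset.mem_Ici] at hi
        rw [Finset.mem_Iic] at hk
        have h1 := ha hi
        have h2 := hbrev hk
        exact hlow i k (hk.trans hi) (by omega)
    · refine det_eq_zero_of_zero_block M (Finset.Iic j) (Finset.Ici j) ?_ ?_
      · rw [Fin.card_Ici, Fin.card_Iic]; omega
      · intro i hi k hk
        rw [Finset.mem_Ici] at hk
        rw [Finset.mem_Iic] at hi
        have h1 := ha hi
        have h2 := hbrev hk
        have h3 : (i : ℕ) ≤ k := hi.trans hk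
        exact hhigh i k (hi.trans hk) (by omega)

end Residue

theorem rowLen_rect_of_lt {a b i : ℕ} (hi : i < a) : (rect a b).rowLen i = b :=
  rowLen_eq_of_mem_iff fun j => by
    rw [← YoungDiagram.mem_cells]
    simp [rect, hi]

theorem rowLen_rect_of_le {a b i : ℕ} (hi : a ≤ i) : (rect a b).rowLen i = 0 :=
  rowLen_eq_of_mem_iff fun j => by
    rw [← YoungDiagram.mem_cells]
    simp [rect]
    omega

theorem rowLen_dualIn_of_lt {a b i : ℕ} (lam : YoungDiagram) (hi : i < a) :
    (dualIn a b lam).rowLen i = b - lam.rowLen (a - 1 - i) :=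
  rowLen_eq_of_mem_iff fun j => by
    rw [← YoungDiagram.mem_cells]
    simp only [dualIn, mem_filter, mem_product, mem_range]
    omega

theorem rowLen_dualIn_of_le {a b i : ℕ} (lam : YoungDiagram) (hi : a ≤ i) :
    (dualIn a b lam).rowLen i = 0 :=
  rowLen_eq_of_mem_iff fun j => by
    rw [← YoungDiagram.mem_cells]
    simp only [dualIn, mem_filter, mem_product, mem_range]
    omega

theorem eq_dualIn_iff {d m : ℕ} {lam mu : YoungDiagram} (hlam : lam ≤ rect d m)
    (hmu : mu.rowLen d = 0) :
    (∀ j : Fin d, parts d lam j + parts d mu j.rev = m) ↔ dualIn d m lam = mu := by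
  have hle : ∀ i < d, lam.rowLen i ≤ m := fun i hi =>
    (rowLen_mono hlam i).trans_eq (rowLen_rect_of_lt hi)
  constructor
  · intro h
    refine ext_rowLen fun i => ?_
    rcases lt_or_ge i d with hi | hi
    · have h1 := h (Fin.rev ⟨i, hi⟩)
      rw [Fin.rev_rev] at h1
      simp only [parts, Fin.val_rev] at h1
      rw [rowLen_dualIn_of_lt lam hi, show d - 1 - i = d - (i + 1) by omega]
      omega
    · rw [rowLen_dualIn_of_le lam hi, rowLen_eq_zero_of_le hmu hi]
  · rintro rfl j
    have h1 := hle j j.2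
    simp only [parts]
    rw [rowLen_dualIn_of_lt lam j.rev.2, Fin.val_rev, show d - 1 - (d - ((j : ℕ) + 1)) = j by omega]
    omega

theorem card_dualIn {d m : ℕ} {lam : YoungDiagram} (hlam : lam ≤ rect d m) :
    (rect d m).card = lam.card + (dualIn d m lam).card := by
  have hlamd : lam.rowLen d = 0 :=
    Nat.le_zero.mp ((rowLen_mono hlam d).trans_eq (rowLen_rect_of_le le_rfl))
  have hdual := rowLen_dualIn_of_le (a := d) (b := m) lam le_rfl
  have h := (eq_dualIn_iff hlam hdual).mpr rfl
  rw [card_eq_sum_rowLen _ (rowLen_rect_of_le le_rfl), card_eq_sum_rowLen _ hlamd,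
    card_eq_sum_rowLen _ hdual, ← Equiv.sum_comp Fin.revPerm
      (fun i : Fin d => (dualIn d m lam).rowLen i), ← Finset.sum_add_distrib]
  refine Finset.sum_congr rfl fun j _ => ?_
  rw [rowLen_rect_of_lt j.2]
  exact (h j).symm

theorem rename_grothPoly (N : ℕ) (mu : YoungDiagram) :
    MvPolynomial.rename (Fin.val : Fin N → ℕ) (grothPoly N MvPolynomial.X (parts N mu)) =
      (restrictedG N mu : MvPolynomial ℕ ℂ) := by
  have h := map_grothPoly (MvPolynomial.rename (R := ℂ) (Fin.val : Fin N → ℕ)).toRingHom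
    MvPolynomial.X (parts N mu)
  refine h.trans ?_
  rw [restrictedG]
  congr 1
  ext i : 1
  simp

theorem mapDomain_val_eq_zero {N : ℕ} (b : Fin N →₀ ℕ) (k : ℕ) (hk : N ≤ k) :
    b.mapDomain Fin.val k = 0 :=
  Finsupp.mapDomain_of_notMem_range _ _ fun ⟨i, hi⟩ => absurd i.2 (by omega)

theorem coeff_grothPoly_X {N : ℕ} {mu : YoungDiagram} (hmu : mu.rowLen N = 0) (b : Fin N →₀ ℕ) :
    (grothPoly N MvPolynomial.X (parts N mu) : MvPolynomial (Fin N) ℂ).coeff b =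
      MvPowerSeries.coeff (b.mapDomain Fin.val) (stableG mu) := by
  rw [← MvPolynomial.coeff_rename_mapDomain _ Fin.val_injective, rename_grothPoly,
    coeff_restrictedG hmu (mapDomain_val_eq_zero b)]

theorem coeff_grothPoly_X_mul {N : ℕ} {lam mu : YoungDiagram} (hlam : lam.rowLen N = 0)
    (hmu : mu.rowLen N = 0) (b : Fin N →₀ ℕ) :
    (grothPoly N MvPolynomial.X (parts N lam) * grothPoly N MvPolynomial.X (parts N mu) :
      MvPolynomial (Fin N) ℂ).coeff b =
      MvPowerSeries.coeff (b.mapDomain Fin.val) (stableG lam * stableG mu) := by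
  rw [← MvPolynomial.coeff_rename_mapDomain _ Fin.val_injective, map_mul, rename_grothPoly,
    rename_grothPoly, coeff_restrictedG_mul hlam hmu (mapDomain_val_eq_zero b)]

/-- The functional on polynomials in `d` variables that extracts, up to the factor
`d ! * sign`, the coefficient of the rectangle. -/
noncomputable def rectFunctional (d m : ℕ) : MvPolynomial (Fin d) ℂ →ₗ[ℂ] ℂ :=
  (productFunctional d (residueMoment (m + (d - 1)) (d - 1))).comp
    (LinearMap.mulLeft ℂ (altDet MvPolynomial.X 0 * altDet MvPolynomial.X 0))

theorem rectFunctional_grothPoly_mul (d m : ℕ) (lam mu : YoungDiagram) :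
    rectFunctional d m (grothPoly d MvPolynomial.X (parts d lam) *
      grothPoly d MvPolynomial.X (parts d mu)) = d.factorial *
        (Equiv.Perm.sign (Fin.revPerm : Equiv.Perm (Fin d)) *
          if ∀ j, parts d lam j + parts d mu j.rev = m then 1 else 0) := by
  rw [rectFunctional, LinearMap.comp_apply, LinearMap.mulLeft_apply, mul_mul_mul_comm,
    altDet_zero_mul_grothPoly _ _ (parts_antitone d lam),
    altDet_zero_mul_grothPoly _ _ (parts_antitone d mu),
    productFunctional_altDet_mul_altDet (parts_antitone d lam) (parts_antitone d mu)]

open Classical in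
theorem rectFunctional_grothPoly (d m : ℕ) {mu : YoungDiagram} (hmu : mu.rowLen d = 0) :
    rectFunctional d m (grothPoly d MvPolynomial.X (parts d mu)) = d.factorial *
        (Equiv.Perm.sign (Fin.revPerm : Equiv.Perm (Fin d)) *
          if mu = rect d m then 1 else 0) := by
  have h0 : (⊥ : YoungDiagram).rowLen d = 0 := rowLen_eq_of_mem_iff fun j => by simp
  have hparts : parts d ⊥ = 0 := funext fun i => rowLen_eq_of_mem_iff fun j => by simp
  have h := rectFunctional_grothPoly_mul d m mu ⊥
  rw [hparts, grothPoly_zero_eq_one, mul_one] at h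
  rw [h]
  congr 3
  refine propext ⟨fun hm => ext_rowLen fun i => ?_, ?_⟩
  · rcases lt_or_ge i d with hi | hi
    · rw [rowLen_rect_of_lt hi]
      exact hm ⟨i, hi⟩
    · rw [rowLen_rect_of_le hi, rowLen_eq_zero_of_le hmu hi]
  · rintro rfl j
    exact rowLen_rect_of_lt j.2

open Classical in
/-- Poincaré duality: the coefficient of the rectangle in a finite expansion. -/
theorem coeff_rect_of_eq_sum {d m : ℕ} {lam mu : YoungDiagram} (hlam : lam ≤ rect d m)
    (S : Finset YoungDiagram) (c : YoungDiagram → ℂ) (hS : rect d m ∈ S)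
    (h : stableG lam * stableG mu = ∑ kappa ∈ S, c kappa • stableG kappa) :
    c (rect d m) = if dualIn d m lam = mu then 1 else 0 := by
  have hlamd : lam.rowLen d = 0 :=
    Nat.le_zero.mp ((rowLen_mono hlam d).trans_eq (rowLen_rect_of_le le_rfl))
  have hcoeff : ∀ a : ℕ →₀ ℕ, (∀ k, d ≤ k → a k = 0) →
      MvPowerSeries.coeff a (stableG lam * stableG mu) =
        ∑ kappa ∈ S.filter (fun kappa => kappa.rowLen d = 0),
          c kappa * MvPowerSeries.coeff a (stableG kappa) := by
    intro a ha
    rw [h, map_sum, Finset.sum_filter_of_ne]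
    · rfl
    · intro kappa _ hc
      by_contra hrow
      exact right_ne_zero_of_mul hc (coeff_stableG_eq_zero hrow ha)
  have hrect : (rect d m).rowLen d = 0 := rowLen_rect_of_le le_rfl
  let E : MvPolynomial (Fin d) ℂ := ∑ kappa ∈ S.filter (fun kappa => kappa.rowLen d = 0),
    c kappa • grothPoly d MvPolynomial.X (parts d kappa)
  have hE : ∀ b : Fin d →₀ ℕ, E.coeff b =
      MvPowerSeries.coeff (b.mapDomain Fin.val) (stableG lam * stableG mu) := by
    intro b
    rw [hcoeff _ (mapDomain_val_eq_zero b), MvPolynomial.coeff_sum]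
    refine Finset.sum_congr rfl fun kappa hkappa => ?_
    rw [MvPolynomial.coeff_smul, coeff_grothPoly_X (mem_filter.mp hkappa).2, smul_eq_mul]
  have hsign : ((Equiv.Perm.sign (Fin.revPerm : Equiv.Perm (Fin d)) : ℤ) : ℂ) ≠ 0 := by
    rcases Int.units_eq_one_or (Equiv.Perm.sign (Fin.revPerm : Equiv.Perm (Fin d))) with h | h <;>
      simp [h]
  have hfact : (d.factorial : ℂ) ≠ 0 := Nat.cast_ne_zero.mpr d.factorial_ne_zero
  have hval : rectFunctional d m E = d.factorial *
      (Equiv.Perm.sign (Fin.revPerm : Equiv.Perm (Fin d)) * c (rect d m)) := by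
    rw [map_sum, Finset.sum_eq_single_of_mem (rect d m) (mem_filter.mpr ⟨hS, hrect⟩)]
    · rw [map_smul, rectFunctional_grothPoly d m hrect, if_pos rfl, smul_eq_mul]
      ring
    · intro kappa hkappa hne
      rw [map_smul, rectFunctional_grothPoly d m (mem_filter.mp hkappa).2, if_neg hne, mul_zero,
        mul_zero, smul_zero]
  by_cases hmu : mu.rowLen d = 0
  · have hEeq : E = grothPoly d MvPolynomial.X (parts d lam) *
        grothPoly d MvPolynomial.X (parts d mu) := by
      ext b
      rw [hE, coeff_grothPoly_X_mul hlamd hmu]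
    rw [hEeq, rectFunctional_grothPoly_mul] at hval
    rw [← mul_left_cancel₀ hsign (mul_left_cancel₀ hfact hval)]
    simp only [eq_dualIn_iff hlam hmu]
  · have hEeq : E = 0 := by
      ext b
      rw [hE, MvPowerSeries.coeff_mul, MvPolynomial.coeff_zero]
      refine Finset.sum_eq_zero fun x hx => ?_
      rw [HasAntidiagonal.mem_antidiagonal] at hx
      rw [coeff_stableG_eq_zero hmu, mul_zero]
      intro k hk
      have := mapDomain_val_eq_zero b k hk
      rw [← hx, Finsupp.add_apply] at this
      omega
    rw [hEeq, map_zero] at hval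
    have hc : c (rect d m) = 0 := by
      simpa [hsign, hfact] using hval.symm
    rw [hc, if_neg]
    rintro rfl
    exact hmu (rowLen_dualIn_of_le lam le_rfl)

open Classical in
theorem IsLRFamily.apply_rect {d m : ℕ} {lam mu : YoungDiagram} {c : YoungDiagram →₀ ℤ}
    (hlam : lam ≤ rect d m) (hc : IsLRFamily lam mu c) :
    c (rect d m) = if dualIn d m lam = mu then 1 else 0 := by
  have h := coeff_rect_of_eq_sum hlam (insert (rect d m) c.support)
    (fun nu => (-1 : ℂ) ^ ((nu.card : ℤ) - (lam.card : ℤ) - (mu.card : ℤ)) * (c nu : ℂ))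
    (mem_insert_self _ _) <| by
      rw [IsLRFamily, Finsupp.sum] at hc
      rw [hc]
      refine Finset.sum_subset (Finset.subset_insert _ _) fun nu _ hnu => ?_
      rw [Finsupp.notMem_support_iff.mp hnu, Int.cast_zero, mul_zero, zero_smul]
  split_ifs at h ⊢ with hmu
  · rw [← hmu, card_dualIn hlam] at h
    simpa using h
  · simpa [zpow_ne_zero] using h

open Classical in
theorem IsDualFamily.hall_rect {g : YoungDiagram → SymFun} (hg : IsDualFamily g) {d m : ℕ}
    {lam : YoungDiagram} (hlam : lam ≤ rect d m) (mu : YoungDiagram) :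
    hall (g (rect d m)) (stableG lam * stableG mu) = if dualIn d m lam = mu then 1 else 0 := by
  obtain ⟨c, hc, -⟩ := existsUnique_isLRFamily (lam := lam) (mu := mu) hg
  rw [hc.hall_eq hg, hc.apply_rect hlam]
  split_ifs with hmu
  · rw [← hmu, card_dualIn hlam]
    simp
  · simp

end KGroth

open Classical in
theorem mainTheorem7 (n d : ℕ) (hd : 1 ≤ d) (hdn : d ≤ n)
    (lam : YoungDiagram) (hlam : lam ≤ KGroth.rect d (n - d)) :
    (∀ mu : YoungDiagram,
      (∃! c : YoungDiagram →₀ ℤ, KGroth.IsLRFamily lam mu c) ∧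
      ∀ c : YoungDiagram →₀ ℤ, KGroth.IsLRFamily lam mu c →
        c (KGroth.rect d (n - d)) = if KGroth.dualIn d (n - d) lam = mu then 1 else 0) ∧
    (∃! g : YoungDiagram → KGroth.SymFun, KGroth.IsDualFamily g) ∧
    (∃! D : KGroth.SymFun →ₗ[ℂ] KGroth.SymFun, KGroth.IsPerp (KGroth.stableG lam) D) ∧
    ∀ (g : YoungDiagram → KGroth.SymFun) (D : KGroth.SymFun →ₗ[ℂ] KGroth.SymFun),
      KGroth.IsDualFamily g → KGroth.IsPerp (KGroth.stableG lam) D →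
        D (g (KGroth.rect d (n - d))) = g (KGroth.dualIn d (n - d) lam) := by
  have hdual := KGroth.existsUnique_isDualFamily
  refine ⟨fun mu => ⟨KGroth.existsUnique_isLRFamily hdual.choose_spec.1,
    fun c hc => by convert hc.apply_rect hlam⟩, hdual, KGroth.existsUnique_isPerp _,
    fun g D hg hD => KGroth.eq_of_hall_stableG fun mu => ?_⟩
  rw [hD _ _ (KGroth.isSymm_stableG mu), hg.hall_rect hlam, hg]
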